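/- Let $n\ge 2$, let $D_k$ denote the closed Euclidean unit ball of $\mathbb R^k$, $|\cdot|$ volume (and surface area for $\partial D_n$), and let $\sigma$ be the uniform probability measure on $S^{n-1}$. For large $N$ put $$\varepsilon_{n,N}=\Big(\frac{|\partial D_n|}{N|D_{n-1}|}\Big)^{\frac1{n-1}},\qquad t_{n,N}=\sqrt{1-\varepsilon_{n,N}^2},\qquad f(N)=(\ln N)^{-(2+\frac4{n-1})}.$$ For random points $X_1,\dots,X_N\in S^{n-1}$ let $$P_{n,N}=\bigcap_{i=1}^N\{x\in\mathbb R^n:\langle X_i,x\rangle\le t_{n,N}\},\qquad W_{n,N}=\{P_{n,N}\subset(1+\tfrac2n)D_n\},$$ and let $m_{n,N}=\mathbb E\big[\,|P_{n,N}\triangle D_n|\;\big|\;W_{n,N}\big]$ be the conditional expectation given the event $W_{n,N}$. (The unconditional expectation is $+\infty$, since $P_{n,N}$ has infinite volume with positive probability; $|P_{n,N}\triangle D_n|=+\infty$ is counted below as a deviation larger than every $\epsilon$.) (i) There are constants $c(n),c_1(n),c_2(n)>0$ and $N_0(n)$ such that for all $N\ge N_0(n)$ and $X_1,\dots,X_N$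 i.i.d. with law $\sigma$: $\Pr(W_{n,N})\ge 1-e^{-c_2(n)N}$, and for every $\epsilon>0$ $$\Pr\Big(\big||P_{n,N}\triangle D_n|-m_{n,N}\big|\ge\epsilon\Big)\le 2e^{-c(n)N^{1+\frac4{n-1}}f(N)\epsilon^2}+e^{-c_1(n)\ln(N)\,N^{\frac12-\frac2{n-1}}}.$$ (ii) The same holds for every probability measure $\mu$ on $S^{n-1}$ of the form $d\mu=g\,d\sigma$ with $g:S^{n-1}\to\mathbb R$ continuous and strictly positive, and $X_1,\dots,X_N$ i.i.d. with law $\mu$, with constants $c,c_1,c_2>0$ and $N_0$ depending only on $n$ and $g$. -/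

import Mathlib

open MeasureTheory ProbabilityTheory Metric
open scoped ENNReal symmDiff

universe u

noncomputable section

namespace RandomPolytope

/-- The unit sphere `S^{n-1}` of `ℝ^n`, as a type. -/
abbrev Sph (n : ℕ) : Type := sphere (0 : EuclideanSpace ℝ (Fin n)) 1

/-- The Euclidean unit ball `D_n`. -/
def unitBall (n : ℕ) : Set (EuclideanSpace ℝ (Fin n)) := closedBall 0 1

/-- The surface measure on `S^{n-1}`; its total mass is `|∂D_n| = n |D_n|`. -/
def surface (n : ℕ) : Measure (Sph n) :=
  (volume : Measure (EuclideanSpace ℝ (Fin n))).toSphere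

/-- The uniform probability measure `σ` on `S^{n-1}` (for `n ≥ 1`). -/
def sigma (n : ℕ) : Measure (Sph n) := (surface n Set.univ)⁻¹ • surface n

/-- The measure `g dσ` on the sphere. -/
def withDens (n : ℕ) (g : Sph n → ℝ) : Measure (Sph n) :=
  (sigma n).withDensity fun x => ENNReal.ofReal (g x)

/-- `ε_{n,N} = (|∂D_n| / (N |D_{n-1}|))^{1/(n-1)}`. -/
def epsN (n N : ℕ) : ℝ :=
  ((surface n).real Set.univ / (N * volume.real (unitBall (n - 1)))) ^ (1 / ((n : ℝ) - 1))

/-- `t_{n,N} = √(1 - ε_{n,N}²)`. -/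
def tN (n N : ℕ) : ℝ := Real.sqrt (1 - epsN n N ^ 2)

/-- The polyhedron `P_{n,N} = ⋂ᵢ {x : ⟨xᵢ, x⟩ ≤ t_{n,N}}` generated by the normals `xᵢ`. -/
def poly {n N : ℕ} (x : Fin N → Sph n) : Set (EuclideanSpace ℝ (Fin n)) :=
  ⋂ i, {y | inner ℝ (x i : EuclideanSpace ℝ (Fin n)) y ≤ tN n N}

/-- The volume `|P_{n,N} ∆ D_n|`, which may be infinite. -/
def symmVol {n N : ℕ} (x : Fin N → Sph n) : ℝ≥0∞ := volume (poly x ∆ unitBall n)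

/-- `P_{n,N} ⊆ (1 + 2/n) D_n`. -/
def Inside {n N : ℕ} (x : Fin N → Sph n) : Prop :=
  poly x ⊆ closedBall 0 (1 + 2 / (n : ℝ))

/-- The conditional expectation `E[ |P_{n,N} ∆ D_n| given P_{n,N} ⊆ (1 + 2/n) D_n ]`.
The unconditional expectation is infinite: the normals lie in a common open half-space with
positive probability, and then `P_{n,N}` has infinite volume. -/
def condMean {n N : ℕ} {Ω : Type*} [MeasurableSpace Ω] (Pr : Measure Ω)
    (X : Fin N → Ω → Sph n) : ℝ≥0∞ :=
  ∫⁻ ω, symmVol (fun i => X i ω) ∂(ProbabilityTheory.cond Pr {ω | Inside fun i => X i ω})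

/-- `|a - b|` in `[0, ∞]` for finite `b`; it is `∞` when `a = ∞`
(subtraction in `ℝ≥0∞` is truncated at `0`). -/
def absSub (a b : ℝ≥0∞) : ℝ≥0∞ := max (a - b) (b - a)

/-- `X₁, …, X_N` are independent random points with common law `μ`. -/
structure IsIID {n N : ℕ} {Ω : Type*} [MeasurableSpace Ω] (Pr : Measure Ω)
    (X : Fin N → Ω → Sph n) (μ : Measure (Sph n)) : Prop where
  measurable : ∀ i, Measurable (X i)
  indep : iIndepFun X Pr
  law : ∀ i, Pr.map (X i) = μ

/-- `f(N) = (ln N)^{-(2 + 4/(n-1))}`. -/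
def fN (n N : ℕ) : ℝ := Real.log N ^ (-(2 + 4 / ((n : ℝ) - 1)))

/-- `2 exp(-c N^{1+4/(n-1)} f(N) ε²) + exp(-c₁ ln N · N^{1/2 - 2/(n-1)})`. -/
def tailBound (n N : ℕ) (c c₁ ε : ℝ) : ℝ :=
  2 * Real.exp (-(c * (N : ℝ) ^ (1 + 4 / ((n : ℝ) - 1)) * fN n N * ε ^ 2))
    + Real.exp (-(c₁ * Real.log N * (N : ℝ) ^ (1 / 2 - 2 / ((n : ℝ) - 1))))

end RandomPolytope

end

noncomputable section

namespace RandomPolytope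

/-! Write `n = d + 1`, `L = ln N`. Only one property of the law is used: a cap of radius `s ≤ 1` has
mass at least `a s^d` (`ChargesCaps`). A continuous positive density is bounded below on the compact
sphere, so it has this property (`exists_chargesCaps_withDens`), and uniform measure is the case `g
= 1`. The volume `|P ∆ D|` does not have bounded differences, since one normal can decide whether
`P` is bounded. Its truncation to the ball of radius `1 + 4 s²` does: replacing a normal alters the
set only in two caps of volume of order `s^(d+2)` (`hasBoundedDifferences_truncVol`). McDiarmid's
inequality then gives Gaussian tails around the mean of the truncation. The rest of `P` is
controlled by empty caps. A point of `P` of norm above `1 + 4 s²` has its direction within `s` of a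
net point whose cap of radius `s/2` contains no normal (`exists_mem_emptyCaps`). A union bound over
a separated net makes `k` empty caps at scale `s`, or a single one at a larger scale `s'`, very
unlikely. Otherwise `P` has height at most `4 s'²` over fewer than `k` sectors, so the discarded
volume is at most of order `k s'² s^d`. The scales are chosen so that caps of radius `s/2` and
`s'/2` have mass at least `5L/N` and `5kL/N`, with `k` about `N^(d/(2(d+2)))`. Then `k s'² s^d` is
at most of the order of `√N (L/N)^(1+2/d)`, which is also the McDiarmid scale `√N s^(d+2)`; its
inverse square is `N^(1+4/d) f(N)`. The exceptional probability is at most `exp(-3kL)`, below the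
second term of the bound. Conditioning on `W` moves the mean by no more than the same scale
(`abs_condMean_sub_integral_le`). For `ε` below a multiple of that scale the claimed bound exceeds
1. -/

/-! ### Volumes of caps and sectors, by comparison with boxes -/

lemma exists_orthonormalBasis_zero_eq {d : ℕ} (x : Sph (d + 1)) :
    ∃ b : OrthonormalBasis (Fin (d + 1)) ℝ (EuclideanSpace ℝ (Fin (d + 1))), b 0 = x := by
  have hx : ‖(x : EuclideanSpace ℝ (Fin (d + 1)))‖ = 1 := by simp
  have h : Orthonormal ℝ (({0} : Set (Fin (d + 1))).domRestrict
      (fun _ : Fin (d + 1) => (x : EuclideanSpace ℝ (Fin (d + 1))))) := by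
    refine ⟨fun _ => hx, fun i j hij => absurd (Subsingleton.elim i j) hij⟩
  obtain ⟨b, hb⟩ := h.exists_orthonormalBasis_extension_of_card_eq (by simp)
  exact ⟨b, hb 0 rfl⟩

lemma volume_box {d : ℕ} (b : OrthonormalBasis (Fin (d + 1)) ℝ (EuclideanSpace ℝ (Fin (d + 1))))
    (α β r : ℝ) :
    volume {y | α ≤ inner ℝ (b 0) y ∧ inner ℝ (b 0) y ≤ β ∧ ∀ j : Fin d, |inner ℝ (b j.succ) y| ≤ r}
      = ENNReal.ofReal (β - α) * ENNReal.ofReal (2 * r) ^ d := by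
  let S : Set (Fin (d + 1) → ℝ) := Set.univ.pi
    (fun j => Fin.cases (Set.Icc α β) (fun _ => Set.Icc (-r) r) j)
  have hS : MeasurableSet S := by
    refine MeasurableSet.univ_pi fun j => ?_
    refine Fin.cases ?_ (fun _ => ?_) j <;> exact measurableSet_Icc
  have hmp := (EuclideanSpace.volume_preserving_symm_measurableEquiv_toLp (Fin (d + 1))).comp
    b.measurePreserving_repr
  have hset : {y | α ≤ inner ℝ (b 0) y ∧ inner ℝ (b 0) y ≤ β ∧
      ∀ j : Fin d, |inner ℝ (b j.succ) y| ≤ r} =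
      ((MeasurableEquiv.toLp 2 (Fin (d + 1) → ℝ)).symm ∘ b.repr) ⁻¹' S := by
    ext y
    simp [S, Set.mem_pi, Fin.forall_fin_succ, abs_le, b.repr_apply_apply, and_assoc]
  rw [hset, hmp.measure_preimage hS.nullMeasurableSet, volume_pi_pi, Fin.prod_univ_succ]
  simp only [Fin.cases_zero, Fin.cases_succ, Real.volume_Icc, Finset.prod_const, Finset.card_univ,
    Fintype.card_fin]
  ring_nf

lemma norm_sq_eq_inner_sq_add_sum {d : ℕ}
    (b : OrthonormalBasis (Fin (d + 1)) ℝ (EuclideanSpace ℝ (Fin (d + 1))))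
    (y : EuclideanSpace ℝ (Fin (d + 1))) :
    ‖y‖ ^ 2 = inner ℝ (b 0) y ^ 2 + ∑ j : Fin d, inner ℝ (b j.succ) y ^ 2 := by
  rw [← b.sum_sq_inner_right y, Fin.sum_univ_succ]

/-- A set of points with axial coordinate in `[α, β]` and distance at most `r` from the axis
lies in a box of width `2 r`. -/
lemma volume_cylinder_le {d : ℕ} (x : Sph (d + 1)) {α β r : ℝ} (hr : 0 ≤ r)
    {A : Set (EuclideanSpace ℝ (Fin (d + 1)))}
    (hA : ∀ y ∈ A, α ≤ inner ℝ (x : EuclideanSpace ℝ (Fin (d + 1))) y ∧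
      inner ℝ (x : EuclideanSpace ℝ (Fin (d + 1))) y ≤ β ∧
      ‖y‖ ^ 2 - inner ℝ (x : EuclideanSpace ℝ (Fin (d + 1))) y ^ 2 ≤ r ^ 2) :
    volume A ≤ ENNReal.ofReal ((β - α) * (2 * r) ^ d) := by
  obtain ⟨b, hb⟩ := exists_orthonormalBasis_zero_eq x
  rw [ENNReal.ofReal_mul' (by positivity), ENNReal.ofReal_pow (by positivity), ← volume_box b]
  refine measure_mono fun y hy => ?_
  obtain ⟨h1, h2, h3⟩ := hA y hy
  rw [← hb] at h1 h2 h3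
  refine ⟨h1, h2, fun j => abs_le_of_sq_le_sq ?_ hr⟩
  have := Finset.single_le_sum (f := fun j : Fin d => inner ℝ (b j.succ) y ^ 2)
    (fun i _ => sq_nonneg _) (Finset.mem_univ j)
  have h4 := norm_sq_eq_inner_sq_add_sum b y
  linarith

lemma dist_normalize_sq {d : ℕ} (x : Sph (d + 1)) {y : EuclideanSpace ℝ (Fin (d + 1))}
    (hy : y ≠ 0) :
    ‖‖y‖⁻¹ • y - x‖ ^ 2 = 2 - 2 * (inner ℝ (x : EuclideanSpace ℝ (Fin (d + 1))) y / ‖y‖) := by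
  have hx : ‖(x : EuclideanSpace ℝ (Fin (d + 1)))‖ = 1 := by simp
  have hy' : ‖y‖ ≠ 0 := norm_ne_zero_iff.mpr hy
  rw [norm_sub_sq_real, hx, norm_smul, norm_inv, norm_norm, inv_mul_cancel₀ hy',
    real_inner_smul_left, real_inner_comm]
  ring

/-- Radial projection to the sphere. -/
def direction {d : ℕ} {y : EuclideanSpace ℝ (Fin (d + 1))} (hy : y ≠ 0) : Sph (d + 1) :=
  ⟨‖y‖⁻¹ • y, by simp [norm_smul, hy]⟩

/-- The surface measure of a set is the dimension times the volume of the cone over it, and the cone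
over the cap contains a box around the axis through `x`, at axial distance between `1/4` and `1/2`
and of transversal half-width `s/(4d)`. -/
lemma surface_closedBall_ge {d : ℕ} (hd : 1 ≤ d) (x : Sph (d + 1)) {s : ℝ} (hs : 0 < s)
    (hs1 : s ≤ 1) :
    ENNReal.ofReal (1 / 4 * (s / (2 * d)) ^ d) ≤ surface (d + 1) (closedBall x s) := by
  obtain ⟨b, hb⟩ := exists_orthonormalBasis_zero_eq x
  have hd' : (1 : ℝ) ≤ d := by exact_mod_cast hd
  have hbox := volume_box b (1 / 4) (1 / 2) (s / (4 * d))
  have hval : ENNReal.ofReal (1 / 4 * (s / (2 * d)) ^ d) =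
      ENNReal.ofReal (1 / 2 - 1 / 4) * ENNReal.ofReal (2 * (s / (4 * d))) ^ d := by
    rw [← ENNReal.ofReal_pow (by positivity), ← ENNReal.ofReal_mul (by norm_num)]
    congr 2
    · norm_num
    · congr 1; field_simp; ring
  rw [hval, ← hbox, surface, Measure.toSphere_apply' _ isClosed_closedBall.measurableSet]
  refine (measure_mono ?_).trans (le_mul_of_one_le_left zero_le ?_)
  · rintro y ⟨h1, h2, h3⟩
    have hsum : ∑ j : Fin d, inner ℝ (b j.succ) y ^ 2 ≤ d * (s / (4 * d)) ^ 2 := by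
      calc _ ≤ ∑ j : Fin d, (s / (4 * d)) ^ 2 :=
            Finset.sum_le_sum fun j _ => sq_le_sq' (abs_le.mp (h3 j)).1 (abs_le.mp (h3 j)).2
        _ = _ := by simp
    have hnorm := norm_sq_eq_inner_sq_add_sum b y
    have hds : d * (s / (4 * d)) ^ 2 = s ^ 2 / (16 * d) := by field_simp; ring
    rw [hds] at hsum
    have hds' : s ^ 2 / (16 * d) ≤ s ^ 2 / 16 := by
      apply div_le_div_of_nonneg_left (by positivity) (by norm_num); linarith
    have hnn : 0 ≤ ∑ j : Fin d, inner ℝ (b j.succ) y ^ 2 := Finset.sum_nonneg fun _ _ => sq_nonneg _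
    set p := inner ℝ (b 0) y with hp
    have hpy : p ≤ ‖y‖ := by
      refine (le_abs_self _).trans (abs_le_of_sq_le_sq ?_ (norm_nonneg _))
      linarith
    have hy0 : 0 < ‖y‖ := by linarith
    have hy : y ≠ 0 := norm_pos_iff.mp hy0
    have hy1 : ‖y‖ < 1 := by nlinarith
    refine Set.mem_smul.mpr ⟨‖y‖, ⟨hy0, hy1⟩, ‖y‖⁻¹ • y, ⟨direction hy, ?_, rfl⟩, ?_⟩
    · rw [mem_closedBall, Subtype.dist_eq, dist_eq_norm]
      refine (le_abs_self _).trans (abs_le_of_sq_le_sq ?_ hs.le)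
      change ‖‖y‖⁻¹ • y - x‖ ^ 2 ≤ _
      rw [dist_normalize_sq x hy, ← hb, ← hp]
      have : 2 - 2 * (p / ‖y‖) = 2 * (‖y‖ - p) / ‖y‖ := by field_simp
      rw [this, div_le_iff₀ hy0]
      nlinarith
    · rw [smul_smul, mul_inv_cancel₀ hy0.ne', one_smul]
  · simp

/-- The part of a ball of radius `1 + h` cut off by a hyperplane at distance at least `1 - h`
from the origin is small. -/
lemma volume_cap_le {d : ℕ} (x : Sph (d + 1)) {h t : ℝ} (h0 : 0 ≤ h) (h1 : h ≤ 1)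
    (ht : 1 - h ≤ t) :
    volume {y : EuclideanSpace ℝ (Fin (d + 1)) | ‖y‖ ≤ 1 + h ∧
      t < inner ℝ (x : EuclideanSpace ℝ (Fin (d + 1))) y}
      ≤ ENNReal.ofReal (2 * h * (4 * √h) ^ d) := by
  have hx : ‖(x : EuclideanSpace ℝ (Fin (d + 1)))‖ = 1 := by simp
  -- Here `1 - h < ⟨x, y⟩ ≤ ‖y‖ ≤ 1 + h`, so the squared distance to the axis is at most `(1 + h)² -
  -- (1 - h)² = 4h`.
  have := volume_cylinder_le x (α := 1 - h) (β := 1 + h) (r := 2 * √h) (by positivity)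
    (A := {y : EuclideanSpace ℝ (Fin (d + 1)) | ‖y‖ ≤ 1 + h ∧
      t < inner ℝ (x : EuclideanSpace ℝ (Fin (d + 1))) y}) ?_
  · convert this using 2; ring
  · rintro y ⟨hy, hty⟩
    have hle := real_inner_le_norm (x : EuclideanSpace ℝ (Fin (d + 1))) y
    rw [hx, one_mul] at hle
    refine ⟨by linarith, by linarith, ?_⟩
    rw [mul_pow, Real.sq_sqrt h0]
    nlinarith [norm_nonneg y]

/-- The volume of a thin piece of a spherical shell over a spherical cap. -/
lemma volume_sector_le {d : ℕ} (v : Sph (d + 1)) {s η : ℝ} (hs : 0 ≤ s) (hη : s ^ 2 ≤ η)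
    (hη1 : η ≤ 1) :
    volume {y : EuclideanSpace ℝ (Fin (d + 1)) | 1 ≤ ‖y‖ ∧ ‖y‖ ≤ 1 + η ∧
      ‖‖y‖⁻¹ • y - v‖ ≤ s} ≤ ENNReal.ofReal (2 * η * (4 * s) ^ d) := by
  have hx : ‖(v : EuclideanSpace ℝ (Fin (d + 1)))‖ = 1 := by simp
  -- With `q ≤ s²` the squared chord from the direction of `y` to `v`, the axial coordinate is `‖y‖
  -- (1 - q/2)` and the squared distance to the axis is `‖y‖² (q - q²/4) ≤ 4 s²`.
  have := volume_cylinder_le v (α := 1 - η) (β := 1 + η) (r := 2 * s) (by positivity)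
    (A := {y : EuclideanSpace ℝ (Fin (d + 1)) | 1 ≤ ‖y‖ ∧ ‖y‖ ≤ 1 + η ∧
      ‖‖y‖⁻¹ • y - v‖ ≤ s}) ?_
  · convert this using 2; ring
  · rintro y ⟨hy1, hy2, hys⟩
    have hle := real_inner_le_norm (v : EuclideanSpace ℝ (Fin (d + 1))) y
    rw [hx, one_mul] at hle
    have hy0 : y ≠ 0 := norm_pos_iff.mp (by linarith)
    have hd := dist_normalize_sq v hy0
    have hq : ‖‖y‖⁻¹ • y - v‖ ^ 2 ≤ s ^ 2 := pow_le_pow_left₀ (norm_nonneg _) hys 2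
    have hq0 := sq_nonneg ‖‖y‖⁻¹ • y - v‖
    set q := ‖‖y‖⁻¹ • y - v‖ ^ 2
    set p := inner ℝ (v : EuclideanSpace ℝ (Fin (d + 1))) y with hp
    have hpq : p = ‖y‖ * (1 - q / 2) := by
      rw [hd]; field_simp; ring
    refine ⟨?_, by linarith, ?_⟩
    · rw [hpq]; nlinarith
    · have : ‖y‖ ^ 2 - p ^ 2 = ‖y‖ ^ 2 * (q - q ^ 2 / 4) := by rw [hpq]; ring
      rw [this, mul_pow]
      have h2 : q - q ^ 2 / 4 ≤ s ^ 2 := by nlinarith [sq_nonneg q]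
      have h3 : ‖y‖ ^ 2 ≤ 2 ^ 2 := pow_le_pow_left₀ (norm_nonneg _) (by linarith) 2
      calc _ ≤ ‖y‖ ^ 2 * s ^ 2 := by gcongr
        _ ≤ _ := by gcongr

/-- If a point of the polytope has norm larger than `1 + h`, then the cap of radius `√h` around its
direction contains no normal. -/
lemma lt_dist_direction_sq {d N : ℕ} {x : Fin N → Sph (d + 1)} (ht1 : tN (d + 1) N ≤ 1)
    {h : ℝ} (h0 : 0 ≤ h) (h1 : h ≤ 1) {y : EuclideanSpace ℝ (Fin (d + 1))} (hy : y ∈ poly x)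
    (hhy : 1 + h < ‖y‖) (i : Fin N) : h < ‖‖y‖⁻¹ • y - x i‖ ^ 2 := by
  have hy0 : 0 < ‖y‖ := by linarith
  rw [dist_normalize_sq _ (norm_pos_iff.mp hy0)]
  have hi : inner ℝ (x i : EuclideanSpace ℝ (Fin (d + 1))) y ≤ tN (d + 1) N :=
    Set.mem_iInter.mp hy i
  have : inner ℝ (x i : EuclideanSpace ℝ (Fin (d + 1))) y / ‖y‖ < 1 / (1 + h) := by
    calc _ ≤ 1 / ‖y‖ := by gcongr; linarith
      _ < _ := by gcongr
  have h2 : 1 / (1 + h) ≤ 1 - h / 2 := by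
    rw [div_le_iff₀ (by linarith)]; nlinarith
  linarith

/-! ### Separated nets and the number of empty caps -/

/-- An `s`-separated set of largest cardinality is an `s`-net. The cardinality is bounded because
the balls of radius `s/2` are disjoint and each has mass at least `p`. -/
lemma exists_separated_net {n : ℕ} (μ : Measure (Sph n)) [IsProbabilityMeasure μ] {s p : ℝ}
    (hs : 0 < s) (hp : 0 < p) (hμ : ∀ u, p ≤ μ.real (closedBall u (s / 2))) :
    ∃ V : Finset (Sph n), (∀ u, ∃ v ∈ V, dist u v ≤ s) ∧
      ((V : Set (Sph n)).PairwiseDisjoint fun v => closedBall v (s / 2)) ∧ V.card * p ≤ 1 := by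
  classical
  let Q : ℕ → Prop := fun m => ∃ V : Finset (Sph n), V.card = m ∧
    (V : Set (Sph n)).Pairwise fun v w => s < dist v w
  have hdisj : ∀ V : Finset (Sph n), ((V : Set (Sph n)).Pairwise fun v w => s < dist v w) →
      ((V : Set (Sph n)).PairwiseDisjoint fun v => closedBall v (s / 2)) := fun V hV v hv w hw hvw =>
    closedBall_disjoint_closedBall (by linarith [hV hv hw hvw])
  have hcard : ∀ V : Finset (Sph n), ((V : Set (Sph n)).Pairwise fun v w => s < dist v w) →
      V.card * p ≤ 1 := by
    intro V hV
    calc V.card * p = ∑ v ∈ V, p := by simp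
      _ ≤ ∑ v ∈ V, μ.real (closedBall v (s / 2)) := Finset.sum_le_sum fun v _ => hμ v
      _ = μ.real (⋃ v ∈ V, closedBall v (s / 2)) := by
          rw [measureReal_biUnion_finset (hdisj V hV) fun v _ => isClosed_closedBall.measurableSet]
      _ ≤ 1 := measureReal_le_one
  have hbound : ∀ m, Q m → m ≤ ⌊1 / p⌋₊ := by
    rintro m ⟨V, rfl, hV⟩
    refine Nat.le_floor ?_
    rw [le_div_iff₀ hp]
    exact hcard V hV
  have hQ0 : Q 0 := ⟨∅, by simp⟩
  obtain ⟨V, hVc, hV⟩ := Nat.findGreatest_spec (P := Q) (Nat.zero_le ⌊1 / p⌋₊) hQ0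
  refine ⟨V, fun u => ?_, hdisj V hV, hcard V hV⟩
  by_contra! hu
  have huV : u ∉ V := fun h => by have := hu u h; simp at this; linarith
  have hQ : Q (V.card + 1) := by
    refine ⟨insert u V, Finset.card_insert_of_notMem huV, ?_⟩
    rw [Finset.coe_insert]
    refine hV.insert fun w hw _ => ⟨hu w hw, ?_⟩
    rw [dist_comm]; exact hu w hw
  have := Nat.le_findGreatest (hbound _ hQ) hQ
  omega

/-- Union bound: it is unlikely that `k` of the given disjoint sets contain no random point. -/
lemma measureReal_card_empty_ge_le {S : Type*} [MeasurableSpace S] (μ : Measure S)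
    [IsProbabilityMeasure μ] (N k : ℕ) {ι : Type*} (V : Finset ι) (B : ι → Set S)
    (hB : ∀ v, MeasurableSet (B v)) (hd : (V : Set ι).PairwiseDisjoint B) {p : ℝ}
    (hμ : ∀ v, p ≤ μ.real (B v)) (J : (Fin N → S) → Finset ι)
    (hJ : ∀ x, ∀ v ∈ J x, v ∈ V ∧ ∀ i, x i ∉ B v) :
    (Measure.pi fun _ : Fin N => μ).real {x | k ≤ (J x).card}
      ≤ (V.card : ℝ) ^ k * Real.exp (-(N * (k * p))) := by
  classical
  -- If `k` sets are empty, some `k`-element subfamily has a union missed by every point; by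
  -- disjointness that union has mass at least `k p`.
  have hsub : {x | k ≤ (J x).card} ⊆ ⋃ A ∈ V.powersetCard k,
      Set.univ.pi fun _ : Fin N => (⋃ v ∈ A, B v)ᶜ := by
    intro x hx
    obtain ⟨A, hA, hAk⟩ := Finset.exists_subset_card_eq (show k ≤ (J x).card from hx)
    simp only [Set.mem_iUnion, Finset.mem_powersetCard, exists_prop]
    refine ⟨A, ⟨fun v hv => (hJ x v (hA hv)).1, hAk⟩, fun i _ => ?_⟩
    simp only [Set.mem_compl_iff, Set.mem_iUnion, not_exists]
    exact fun v hv => (hJ x v (hA hv)).2 i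
  have hone : ∀ A ∈ V.powersetCard k,
      (Measure.pi fun _ : Fin N => μ).real (Set.univ.pi fun _ : Fin N => (⋃ v ∈ A, B v)ᶜ)
        ≤ Real.exp (-(N * (k * p))) := by
    intro A hA
    obtain ⟨hAV, hAk⟩ := Finset.mem_powersetCard.mp hA
    have hm : MeasurableSet (⋃ v ∈ A, B v) := Finset.measurableSet_biUnion _ fun v _ => hB v
    have hle : μ.real (⋃ v ∈ A, B v)ᶜ ≤ Real.exp (-(k * p)) := by
      rw [probReal_compl_eq_one_sub hm,
        measureReal_biUnion_finset (hd.subset (by exact_mod_cast hAV)) fun v _ => hB v]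
      have : k * p ≤ ∑ v ∈ A, μ.real (B v) := by
        calc k * p = ∑ v ∈ A, p := by simp [hAk]
          _ ≤ _ := Finset.sum_le_sum fun v _ => hμ v
      linarith [Real.add_one_le_exp (-(k * p))]
    have : (Measure.pi fun _ : Fin N => μ).real (Set.univ.pi fun _ : Fin N => (⋃ v ∈ A, B v)ᶜ)
        = μ.real (⋃ v ∈ A, B v)ᶜ ^ N := by
      simp [measureReal_def, Measure.pi_pi]
    rw [this]
    calc _ ≤ Real.exp (-(k * p)) ^ N := pow_le_pow_left₀ measureReal_nonneg hle N
      _ = _ := by rw [← Real.exp_nat_mul]; congr 1; ring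
  calc _ ≤ (Measure.pi fun _ : Fin N => μ).real (⋃ A ∈ V.powersetCard k,
      Set.univ.pi fun _ : Fin N => (⋃ v ∈ A, B v)ᶜ) := measureReal_mono hsub (measure_ne_top _ _)
    _ ≤ ∑ A ∈ V.powersetCard k, _ := measureReal_biUnion_finset_le _ _
    _ ≤ ∑ A ∈ V.powersetCard k, Real.exp (-(N * (k * p))) := Finset.sum_le_sum hone
    _ = V.card.choose k * Real.exp (-(N * (k * p))) := by simp [Finset.card_powersetCard]
    _ ≤ _ := by
      gcongr
      exact_mod_cast Nat.choose_le_pow _ _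

/-! ### The bounded differences inequality -/

section BoundedDifferences

variable {S : Type*}

/-- Changing one coordinate changes `f` by at most `c`. -/
def HasBoundedDifferences {N : ℕ} (f : (Fin N → S) → ℝ) (c : ℝ) : Prop :=
  ∀ x i s, |f (Function.update x i s) - f x| ≤ c

lemma HasBoundedDifferences.cons {N : ℕ} {f : (Fin (N + 1) → S) → ℝ} {c : ℝ}
    (hf : HasBoundedDifferences f c) (s : S) :
    HasBoundedDifferences (fun y : Fin N → S => f (Fin.cons s y)) c := by
  intro x i r
  have := hf (Fin.cons s x) i.succ r
  rwa [← Fin.cons_update] at this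

/-- Changing the coordinates one after another leads to a fixed point. This boundedness supplies all
the integrability needed below. -/
lemma HasBoundedDifferences.bounded {N : ℕ} {f : (Fin N → S) → ℝ} {c : ℝ}
    (hf : HasBoundedDifferences f c) : ∃ C, ∀ x, |f x| ≤ C := by
  induction N with
  | zero => exact ⟨|f Fin.elim0|, fun x => by rw [Subsingleton.elim x Fin.elim0]⟩
  | succ N ih =>
    rcases isEmpty_or_nonempty S with hS | ⟨⟨s₀⟩⟩
    · exact ⟨0, fun x => isEmptyElim (x 0)⟩
    · obtain ⟨C, hC⟩ := ih (hf.cons s₀)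
      refine ⟨C + c, fun x => ?_⟩
      have h1 := hC (Fin.tail x)
      have h2 := hf (Fin.cons s₀ (Fin.tail x)) 0 (x 0)
      rw [Fin.update_cons_zero, Fin.cons_self_tail] at h2
      calc |f x| = |f (Fin.cons s₀ (Fin.tail x)) + (f x - f (Fin.cons s₀ (Fin.tail x)))| := by
            congr 1; ring
        _ ≤ _ := (abs_add_le _ _).trans (add_le_add h1 h2)

lemma HasBoundedDifferences.neg {N : ℕ} {f : (Fin N → S) → ℝ} {c : ℝ}
    (hf : HasBoundedDifferences f c) : HasBoundedDifferences (fun x => -f x) c := by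
  intro x i s
  rw [← abs_neg]
  convert hf x i s using 2
  ring

variable [MeasurableSpace S]

/-- Hoeffding's lemma. The interval of values is taken as `[f s₀ - c, f s₀ + c]`, of length `2c`
instead of the optimal `c`; this is where the constant is lost. -/
lemma integral_exp_sub_integral_le {μ : Measure S} [IsProbabilityMeasure μ] {f : S → ℝ}
    (hm : Measurable f) {c : ℝ} (hc : 0 ≤ c) (hf : ∀ s r, |f s - f r| ≤ c) (l : ℝ) :
    ∫ s, Real.exp (l * (f s - ∫ r, f r ∂μ)) ∂μ ≤ Real.exp (c ^ 2 * l ^ 2 / 2) := by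
  obtain ⟨s₀⟩ : Nonempty S := nonempty_of_isProbabilityMeasure μ
  have h := hasSubgaussianMGF_of_mem_Icc (μ := μ) (X := f) hm.aemeasurable (a := f s₀ - c)
    (b := f s₀ + c) (ae_of_all _ fun s => by
      have := abs_le.mp (hf s s₀); constructor <;> linarith)
  refine (h.mgf_le l).trans_eq ?_
  congr 2
  have : f s₀ + c - (f s₀ - c) = 2 * c := by ring
  simp [this, abs_of_nonneg hc]

/-- Induction on the number of coordinates: averaging over the first one leaves a function `g` of
the others with the same bounded differences, while Hoeffding's lemma on each fibre bounds the
fluctuation of `F` around `g`. The two exponential factors multiply. -/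
lemma integral_exp_le_of_hasBoundedDifferences (μ : Measure S) [IsProbabilityMeasure μ] {N : ℕ}
    {f : (Fin N → S) → ℝ} (hm : Measurable f) {c : ℝ} (hc : 0 ≤ c)
    (hf : HasBoundedDifferences f c) (l : ℝ) :
    ∫ x, Real.exp (l * (f x - ∫ y, f y ∂Measure.pi fun _ => μ)) ∂(Measure.pi fun _ => μ)
      ≤ Real.exp (N * c ^ 2 * l ^ 2 / 2) := by
  induction N with
  | zero =>
    have hx : ∀ x : Fin 0 → S, f x = f Fin.elim0 := fun x => by rw [Subsingleton.elim x Fin.elim0]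
    simp [hx]
  | succ N ih =>
    let π : Measure (Fin N → S) := Measure.pi fun _ => μ
    let F : S × (Fin N → S) → ℝ := fun z => f (Fin.cons z.1 z.2)
    have he : ∀ z, (MeasurableEquiv.piFinSuccAbove (fun _ : Fin (N + 1) => S) 0).symm z
        = Fin.cons z.1 z.2 := fun z => by
      simp [MeasurableEquiv.piFinSuccAbove, Fin.insertNthEquiv]
    have hFm : Measurable F := by
      have := hm.comp (MeasurableEquiv.piFinSuccAbove (fun _ : Fin (N + 1) => S) 0).symm.measurable
      simpa only [Function.comp_def, he] using this
    obtain ⟨C, hC⟩ := hf.bounded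
    have htr : ∀ φ : ℝ → ℝ, ∫ x, φ (f x) ∂(Measure.pi fun _ => μ)
        = ∫ z, φ (F z) ∂(μ.prod π) := fun φ => by
      have := ((measurePreserving_piFinSuccAbove (fun _ : Fin (N + 1) => μ) 0).symm).integral_comp'
        (fun x => φ (f x))
      simpa only [he] using this.symm
    have hFint : Integrable F (μ.prod π) :=
      Integrable.of_bound hFm.aestronglyMeasurable C (ae_of_all _ fun z => hC _)
    let g : (Fin N → S) → ℝ := fun y => ∫ s, F (s, y) ∂μ
    have hgm : Measurable g :=
      (hFm.stronglyMeasurable.integral_prod_left' (μ := μ)).measurable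
    have hFsec : ∀ y, Integrable (fun s => F (s, y)) μ := fun y =>
      Integrable.of_bound (hFm.comp measurable_prodMk_right).aestronglyMeasurable C
        (ae_of_all _ fun z => hC _)
    have hgd : HasBoundedDifferences g c := by
      intro x i r
      simp only [g]
      rw [← integral_sub (hFsec _) (hFsec _)]
      have := norm_integral_le_of_norm_le_const (μ := μ)
        (f := fun s => F (s, Function.update x i r) - F (s, x)) (C := c)
        (ae_of_all _ fun s => hf.cons s x i r)
      simpa using this
    have hgE : ∫ y, g y ∂π = ∫ x, f x ∂(Measure.pi fun _ => μ) := by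
      rw [show ∫ x, f x ∂(Measure.pi fun _ => μ) = _ from htr id]
      exact (integral_prod_symm _ hFint).symm
    rw [htr (fun r => Real.exp (l * (r - ∫ y, f y ∂Measure.pi fun _ => μ))), ← hgE]
    set m := ∫ y, g y ∂π
    have hexpb : ∀ (r : ℝ), |r| ≤ C → Real.exp (l * (r - m)) ≤ Real.exp (|l| * (C + |m|)) := by
      intro r hr
      refine Real.exp_le_exp.mpr ?_
      calc l * (r - m) ≤ |l * (r - m)| := le_abs_self _
        _ = |l| * |r - m| := abs_mul _ _
        _ ≤ |l| * (C + |m|) := by gcongr; exact (abs_sub _ _).trans (by gcongr)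
    have hexpint : Integrable (fun z => Real.exp (l * (F z - m))) (μ.prod π) := by
      refine Integrable.of_bound (by fun_prop) (Real.exp (|l| * (C + |m|)))
        (ae_of_all _ fun z => ?_)
      rw [Real.norm_eq_abs, Real.abs_exp]
      exact hexpb _ (hC _)
    rw [integral_prod_symm _ hexpint]
    have hinner : ∀ y, ∫ s, Real.exp (l * (F (s, y) - m)) ∂μ
        ≤ Real.exp (c ^ 2 * l ^ 2 / 2) * Real.exp (l * (g y - m)) := by
      intro y
      have heq : ∀ s, Real.exp (l * (F (s, y) - m)) =
          Real.exp (l * (g y - m)) * Real.exp (l * (F (s, y) - g y)) := fun s => by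
        rw [← Real.exp_add]; congr 1; ring
      simp_rw [heq]
      rw [integral_const_mul, mul_comm]
      refine mul_le_mul_of_nonneg_right ?_ (Real.exp_pos _).le
      refine integral_exp_sub_integral_le (hFm.comp measurable_prodMk_right) hc (fun s r => ?_) l
      have := hf (Fin.cons r y) 0 s
      rwa [Fin.update_cons_zero] at this
    have hgC : ∀ y, |g y| ≤ C := fun y => by
      have := norm_integral_le_of_norm_le_const (μ := μ) (f := fun s => F (s, y)) (C := C)
        (ae_of_all _ fun s => hC _)
      simpa using this
    calc ∫ y, ∫ s, Real.exp (l * (F (s, y) - m)) ∂μ ∂π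
        ≤ ∫ y, Real.exp (c ^ 2 * l ^ 2 / 2) * Real.exp (l * (g y - m)) ∂π := by
          refine integral_mono hexpint.integral_prod_right ?_ hinner
          refine Integrable.const_mul (Integrable.of_bound (by fun_prop)
            (Real.exp (|l| * (C + |m|))) (ae_of_all _ fun y => ?_)) _
          rw [Real.norm_eq_abs, Real.abs_exp]
          exact hexpb _ (hgC _)
      _ = Real.exp (c ^ 2 * l ^ 2 / 2) * ∫ y, Real.exp (l * (g y - m)) ∂π := integral_const_mul _ _
      _ ≤ Real.exp (c ^ 2 * l ^ 2 / 2) * Real.exp (N * c ^ 2 * l ^ 2 / 2) := by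
          gcongr; exact ih hgm hgd
      _ = _ := by rw [← Real.exp_add]; congr 1; push_cast; ring

lemma measureReal_sub_integral_ge_le (μ : Measure S) [IsProbabilityMeasure μ] {N : ℕ}
    {f : (Fin N → S) → ℝ} (hm : Measurable f) {c : ℝ} (hc : 0 ≤ c)
    (hf : HasBoundedDifferences f c) {ε : ℝ} (hε : 0 ≤ ε) :
    (Measure.pi fun _ => μ).real {x | ε ≤ f x - ∫ y, f y ∂Measure.pi fun _ => μ}
      ≤ Real.exp (-ε ^ 2 / (2 * (N * c ^ 2))) := by
  obtain ⟨C, hC⟩ := hf.bounded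
  set m := ∫ y, f y ∂Measure.pi fun _ => μ with hmdef
  have h : HasSubgaussianMGF (fun x => f x - m) (N * ⟨c, hc⟩ ^ 2) (Measure.pi fun _ => μ) := by
    refine ⟨fun t => ?_, fun t => ?_⟩
    · refine Integrable.of_bound (by fun_prop) (Real.exp (|t| * (C + |m|)))
        (ae_of_all _ fun x => ?_)
      rw [Real.norm_eq_abs, Real.abs_exp]
      refine Real.exp_le_exp.mpr ?_
      calc t * (f x - m) ≤ |t * (f x - m)| := le_abs_self _
        _ = |t| * |f x - m| := abs_mul _ _
        _ ≤ |t| * (C + |m|) := by gcongr; exact (abs_sub _ _).trans (by gcongr; exact hC x)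
    · exact integral_exp_le_of_hasBoundedDifferences μ hm hc hf t
  exact h.measure_ge_le hε

/-- **McDiarmid's inequality** (with a non-optimal constant). -/
theorem measureReal_abs_sub_integral_ge_le (μ : Measure S) [IsProbabilityMeasure μ] {N : ℕ}
    {f : (Fin N → S) → ℝ} (hm : Measurable f) {c : ℝ} (hc : 0 ≤ c)
    (hf : HasBoundedDifferences f c) {ε : ℝ} (hε : 0 ≤ ε) :
    (Measure.pi fun _ => μ).real {x | ε ≤ |f x - ∫ y, f y ∂Measure.pi fun _ => μ|}
      ≤ 2 * Real.exp (-ε ^ 2 / (2 * (N * c ^ 2))) := by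
  have h1 := measureReal_sub_integral_ge_le μ hm hc hf hε
  have h2 := measureReal_sub_integral_ge_le μ (f := fun x => -f x) hm.neg hc hf.neg hε
  rw [integral_neg] at h2
  calc _ ≤ (Measure.pi fun _ => μ).real
        ({x | ε ≤ f x - ∫ y, f y ∂Measure.pi fun _ => μ} ∪
          {x | ε ≤ -f x - -∫ y, f y ∂Measure.pi fun _ => μ}) := by
        refine measureReal_mono fun x hx => ?_
        rcases le_abs.mp (Set.mem_ofPred_eq ▸ hx) with h | h
        · exact Or.inl h
        · refine Or.inr (le_of_le_of_eq h ?_); ring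
    _ ≤ _ := (measureReal_union_le _ _).trans (by linarith)

end BoundedDifferences

/-! ### Measurability of the volume and of the event `W` -/

lemma measurableSet_mem_poly (n N : ℕ) :
    MeasurableSet {z : (Fin N → Sph n) × EuclideanSpace ℝ (Fin n) | z.2 ∈ poly z.1} := by
  simp only [poly, Set.mem_iInter, Set.mem_ofPred_eq, Set.ofPred_forall]
  refine MeasurableSet.iInter fun i => measurableSet_le ?_ measurable_const
  fun_prop

lemma measurable_volume_symmDiff_inter (n N : ℕ) {B : Set (EuclideanSpace ℝ (Fin n))}
    (hB : MeasurableSet B) :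
    Measurable fun x : Fin N → Sph n => volume ((poly x ∆ unitBall n) ∩ B) := by
  have h : MeasurableSet ({z : (Fin N → Sph n) × EuclideanSpace ℝ (Fin n) | z.2 ∈ poly z.1} ∆
      (Prod.snd ⁻¹' unitBall n) ∩ Prod.snd ⁻¹' B) :=
    ((measurableSet_mem_poly n N).symmDiff
      (isClosed_closedBall.measurableSet.preimage measurable_snd)).inter
      (hB.preimage measurable_snd)
  exact measurable_measure_prodMk_left h

lemma measurable_symmVol (n N : ℕ) : Measurable fun x : Fin N → Sph n => symmVol x := by
  simpa [symmVol] using measurable_volume_symmDiff_inter n N MeasurableSet.univ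

/-- The polyhedron is star-shaped about the origin because `tN`, being a square root, is nonnegative
for every `N`. -/
lemma smul_mem_poly {n N : ℕ} {x : Fin N → Sph n} {y : EuclideanSpace ℝ (Fin n)}
    (hy : y ∈ poly x) {r : ℝ} (h0 : 0 ≤ r) (h1 : r ≤ 1) : r • y ∈ poly x := by
  refine Set.mem_iInter.mpr fun i => ?_
  have hi : inner ℝ (x i : EuclideanSpace ℝ (Fin n)) y ≤ tN n N := Set.mem_iInter.mp hy i
  have ht : 0 ≤ tN n N := Real.sqrt_nonneg _
  rw [Set.mem_ofPred_eq, real_inner_smul_right]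
  nlinarith

/-- By star-shapedness, `Inside` fails exactly when the polyhedron meets a sphere of some rational
radius above `1 + 2/n`. For each radius this is a closed condition on the normals: it is the
projection of a closed set along a compact sphere. -/
lemma measurableSet_inside (n N : ℕ) : MeasurableSet {x : Fin N → Sph n | Inside x} := by
  have hcl : ∀ q : ℝ, IsClosed {x : Fin N → Sph n | ∃ y ∈ sphere 0 q, y ∈ poly x} := by
    intro q
    have h : IsClosed {z : (Fin N → Sph n) × sphere (0 : EuclideanSpace ℝ (Fin n)) q |
        (z.2 : EuclideanSpace ℝ (Fin n)) ∈ poly z.1} := by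
      simp only [poly, Set.mem_iInter, Set.mem_ofPred_eq, Set.ofPred_forall]
      refine isClosed_iInter fun i => isClosed_le ?_ continuous_const
      fun_prop
    convert isClosedMap_fst_of_compactSpace _ h using 1
    ext x
    simp [and_comm]
  have hset : {x : Fin N → Sph n | Inside x} = ⋂ (q : ℚ) (_ : 1 + 2 / (n : ℝ) < q),
      {x : Fin N → Sph n | ∃ y ∈ sphere 0 (q : ℝ), y ∈ poly x}ᶜ := by
    ext x
    simp only [Set.mem_ofPred_eq, Set.mem_iInter, Set.mem_compl_iff, not_exists, not_and]
    constructor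
    · intro hx q hq y hy hyP
      have := hx hyP
      rw [mem_closedBall] at this
      rw [mem_sphere] at hy
      linarith
    · intro hx y hy
      by_contra hny
      rw [mem_closedBall, dist_zero_right, not_le] at hny
      obtain ⟨q, hq1, hq2⟩ := exists_rat_btwn hny
      have hn : (0 : ℝ) ≤ 2 / n := by positivity
      have hy0 : 0 < ‖y‖ := by linarith
      refine hx q hq1 ((q / ‖y‖ : ℝ) • y) ?_ (smul_mem_poly hy (by apply div_nonneg <;> linarith) ?_)
      · rw [mem_sphere_zero_iff_norm, norm_smul, Real.norm_eq_abs, abs_of_nonneg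
          (by apply div_nonneg <;> linarith), div_mul_cancel₀ _ hy0.ne']
      · rw [div_le_one hy0]; exact hq2.le
  rw [hset]
  exact MeasurableSet.iInter fun q => MeasurableSet.iInter fun _ => (hcl q).measurableSet.compl

lemma measurable_absSub : Measurable fun z : ℝ≥0∞ × ℝ≥0∞ => absSub z.1 z.2 :=
  (measurable_fst.sub measurable_snd).max (measurable_snd.sub measurable_fst)

lemma absSub_eq {a b : ℝ≥0∞} (ha : a ≠ ∞) (hb : b ≠ ∞) :
    absSub a b = ENNReal.ofReal |a.toReal - b.toReal| := by
  lift a to NNReal using ha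
  lift b to NNReal using hb
  rcases le_total a b with h | h
  · have : (a : ℝ) ≤ b := h
    rw [absSub, tsub_eq_zero_of_le (by exact_mod_cast h), ENNReal.coe_toReal, ENNReal.coe_toReal,
      abs_of_nonpos (by linarith), neg_sub, ENNReal.ofReal_sub _ a.coe_nonneg]
    simp
  · have : (b : ℝ) ≤ a := h
    rw [absSub, tsub_eq_zero_of_le (a := (b : ℝ≥0∞)) (by exact_mod_cast h), ENNReal.coe_toReal,
      ENNReal.coe_toReal, abs_of_nonneg (by linarith), ENNReal.ofReal_sub _ b.coe_nonneg]
    simp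

/-! ### Comparison of the conditional mean with the mean of a bounded approximation -/

section Conditioning

variable {Ω : Type*} [MeasurableSpace Ω] {π : Measure Ω} [IsProbabilityMeasure π]
  {F : Ω → ℝ≥0∞} {G : Ω → ℝ} {W A : Set Ω} {C q δ : ℝ}

/-- Conditioning on an event of large probability hardly changes the mean of a bounded function. -/
lemma abs_integral_cond_sub_le (hG : Measurable G) (hW : MeasurableSet W)
    (hG0 : ∀ ω, 0 ≤ G ω) (hGC : ∀ ω, G ω ≤ C) (hπW : 0 < π.real W) :
    |∫ ω, G ω ∂(ProbabilityTheory.cond π W) - ∫ ω, G ω ∂π| ≤ C * π.real Wᶜ := by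
  have hint : Integrable G π := Integrable.of_bound hG.aestronglyMeasurable C
    (ae_of_all _ fun ω => by rw [Real.norm_eq_abs, abs_of_nonneg (hG0 ω)]; exact hGC ω)
  have h1 : ∫ ω, G ω ∂(ProbabilityTheory.cond π W) = (π.real W)⁻¹ * ∫ ω in W, G ω ∂π := by
    rw [ProbabilityTheory.cond, integral_smul_measure, ENNReal.toReal_inv, smul_eq_mul]
    rfl
  have h2 := integral_add_compl hW hint
  have h3 : π.real W = 1 - π.real Wᶜ := by rw [probReal_compl_eq_one_sub hW]; ring
  have bound : ∀ S : Set Ω, MeasurableSet S →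
      0 ≤ ∫ ω in S, G ω ∂π ∧ ∫ ω in S, G ω ∂π ≤ C * π.real S := by
    intro S hS
    refine ⟨integral_nonneg hG0, ?_⟩
    calc _ ≤ ∫ _ in S, C ∂π := integral_mono hint.integrableOn (by simp) hGC
      _ = _ := by simp [mul_comm]
  obtain ⟨a1, a2⟩ := bound W hW
  obtain ⟨b1, b2⟩ := bound _ hW.compl
  have hI : (π.real W)⁻¹ * ∫ ω in W, G ω ∂π - ∫ ω in W, G ω ∂π
      = (π.real W)⁻¹ * (∫ ω in W, G ω ∂π) * π.real Wᶜ := by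
    have : π.real Wᶜ = 1 - π.real W := by linarith
    rw [this]; field_simp
  have hI1 : (π.real W)⁻¹ * (∫ ω in W, G ω ∂π) ≤ C := by
    rw [inv_mul_le_iff₀ hπW]; linarith
  have hI0 : 0 ≤ (π.real W)⁻¹ * (∫ ω in W, G ω ∂π) := by positivity
  have hI2 : (π.real W)⁻¹ * (∫ ω in W, G ω ∂π) * π.real Wᶜ ≤ C * π.real Wᶜ := by gcongr
  have hI3 : 0 ≤ (π.real W)⁻¹ * (∫ ω in W, G ω ∂π) * π.real Wᶜ := by positivity
  rw [h1, ← h2, abs_le]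
  constructor <;> linarith

/-- Under the conditional law, `F` and `G` differ by at most `q` off `A` and by at most `C` on `A`,
whose conditional mass is at most `2δ`. This costs `q + 2Cδ`; removing the conditioning from the
mean of `G` costs another `Cδ`. -/
lemma abs_condMean_sub_integral_le (hF : Measurable F) (hG : Measurable G)
    (hW : MeasurableSet W) (hA : MeasurableSet A) (hG0 : ∀ ω, 0 ≤ G ω) (hGC : ∀ ω, G ω ≤ C)
    (hFW : ∀ ω ∈ W, F ω ≤ ENNReal.ofReal C) (hC : 0 ≤ C) (hq : 0 ≤ q)
    (hAW : ∀ ω ∉ A, ω ∈ W ∧ |(F ω).toReal - G ω| ≤ q)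
    (hAδ : π.real A ≤ δ) (hδ : δ ≤ 1 / 2) :
    (∫⁻ ω, F ω ∂(ProbabilityTheory.cond π W)) ≠ ∞ ∧
    |(∫⁻ ω, F ω ∂(ProbabilityTheory.cond π W)).toReal - ∫ ω, G ω ∂π| ≤ q + 3 * C * δ := by
  have hWA : π.real Wᶜ ≤ π.real A := measureReal_mono fun ω hω => by
    by_contra h; exact hω (hAW ω h).1
  have hπW : 1 / 2 ≤ π.real W := by
    have : π.real W = 1 - π.real Wᶜ := by rw [probReal_compl_eq_one_sub hW]; ring
    linarith
  have hW0 : π W ≠ 0 := fun h => by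
    rw [measureReal_def, h] at hπW; norm_num at hπW
  have := cond_isProbabilityMeasure hW0
  set κ := ProbabilityTheory.cond π W
  have haeW : ∀ᵐ ω ∂κ, ω ∈ W := ae_cond_mem hW
  have hle : ∫⁻ ω, F ω ∂κ ≤ ENNReal.ofReal C := by
    calc _ ≤ ∫⁻ _, ENNReal.ofReal C ∂κ :=
          lintegral_mono_ae (haeW.mono fun ω hω => hFW ω hω)
      _ = _ := by simp
  refine ⟨(hle.trans_lt ENNReal.ofReal_lt_top).ne, ?_⟩
  have hFfin : ∀ᵐ ω ∂κ, F ω < ∞ :=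
    haeW.mono fun ω hω => (hFW ω hω).trans_lt ENNReal.ofReal_lt_top
  rw [← integral_toReal hF.aemeasurable hFfin]
  have hFle : ∀ ω ∈ W, (F ω).toReal ≤ C := fun ω hω => ENNReal.toReal_le_of_le_ofReal hC (hFW ω hω)
  have hF'int : Integrable (fun ω => (F ω).toReal) κ :=
    Integrable.of_bound hF.ennreal_toReal.aestronglyMeasurable C
      (haeW.mono fun ω hω => by
        rw [Real.norm_eq_abs, abs_of_nonneg ENNReal.toReal_nonneg]; exact hFle ω hω)
  have hGint : Integrable G κ := Integrable.of_bound hG.aestronglyMeasurable C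
    (ae_of_all _ fun ω => by rw [Real.norm_eq_abs, abs_of_nonneg (hG0 ω)]; exact hGC ω)
  have hκA : κ.real A ≤ 2 * δ := by
    rw [measureReal_def, cond_apply hW, ENNReal.toReal_mul, ENNReal.toReal_inv]
    change (π.real W)⁻¹ * π.real (W ∩ A) ≤ _
    have h1 : π.real (W ∩ A) ≤ δ := (measureReal_mono Set.inter_subset_right).trans hAδ
    rw [inv_mul_le_iff₀ (by linarith)]
    have : 0 ≤ π.real (W ∩ A) := measureReal_nonneg
    nlinarith
  have hfirst : |∫ ω, (F ω).toReal ∂κ - ∫ ω, G ω ∂κ| ≤ q + C * κ.real A := by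
    rw [← integral_sub hF'int hGint]
    calc _ ≤ ∫ ω, |(F ω).toReal - G ω| ∂κ := abs_integral_le_integral_abs
      _ ≤ ∫ ω, (q + A.indicator (fun _ => C) ω) ∂κ := by
          refine integral_mono_ae (hF'int.sub hGint).abs
            ((integrable_const _).add ((integrable_const _).indicator hA)) (haeW.mono fun ω hω => ?_)
          by_cases hωA : ω ∈ A
          · have h1 := hFle ω hω
            have h2 : 0 ≤ (F ω).toReal := ENNReal.toReal_nonneg
            have h3 := hG0 ω
            have h4 := hGC ω
            simp only [Set.indicator_of_mem hωA]
            rw [abs_le]; constructor <;> linarith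
          · simpa [Set.indicator_of_notMem hωA] using (hAW ω hωA).2
      _ = q + C * κ.real A := by
          rw [integral_add (integrable_const _) ((integrable_const _).indicator hA),
            integral_indicator_const _ hA]
          simp [mul_comm]
  have hsecond := abs_integral_cond_sub_le hG hW hG0 hGC (by linarith)
  have h1 : C * κ.real A ≤ C * (2 * δ) := by gcongr
  have h2 : C * π.real Wᶜ ≤ C * δ := by gcongr; linarith
  calc _ ≤ _ := abs_sub_le _ (∫ ω, G ω ∂κ) _
    _ ≤ _ := by linarith

/-- Off `A`, replacing `F` by `G` costs `q` and replacing the conditional mean by the mean of `G`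
costs `q + 3Cδ`. The hypothesis on `ε` says that together they use at most `ε/2`. -/
lemma measureReal_deviation_le (hF : Measurable F) (hG : Measurable G)
    (hW : MeasurableSet W) (hA : MeasurableSet A) (hG0 : ∀ ω, 0 ≤ G ω) (hGC : ∀ ω, G ω ≤ C)
    (hFW : ∀ ω ∈ W, F ω ≤ ENNReal.ofReal C) (hC : 0 ≤ C) (hq : 0 ≤ q)
    (hAW : ∀ ω ∉ A, ω ∈ W ∧ |(F ω).toReal - G ω| ≤ q)
    (hAδ : π.real A ≤ δ) (hδ : δ ≤ 1 / 2) {ε : ℝ} (hε : 4 * q + 6 * C * δ ≤ ε) :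
    π.real {ω | ENNReal.ofReal ε ≤ absSub (F ω) (∫⁻ ω, F ω ∂(ProbabilityTheory.cond π W))}
      ≤ π.real {ω | ε / 2 ≤ |G ω - ∫ ω, G ω ∂π|} + δ := by
  obtain ⟨hm, hmG⟩ := abs_condMean_sub_integral_le hF hG hW hA hG0 hGC hFW hC hq hAW hAδ hδ
  set m := ∫⁻ ω, F ω ∂(ProbabilityTheory.cond π W)
  refine (measureReal_mono (s₂ := {ω | ε / 2 ≤ |G ω - ∫ ω, G ω ∂π|} ∪ A) fun ω hω => ?_).trans
    ((measureReal_union_le _ _).trans (by linarith))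
  by_cases hωA : ω ∈ A
  · exact Or.inr hωA
  obtain ⟨hωW, hωq⟩ := hAW ω hωA
  refine Or.inl ?_
  have hFfin : F ω ≠ ∞ := ((hFW ω hωW).trans_lt ENNReal.ofReal_lt_top).ne
  have h : ENNReal.ofReal ε ≤ absSub (F ω) m := hω
  rw [absSub_eq hFfin hm, ENNReal.ofReal_le_ofReal_iff (abs_nonneg _)] at h
  have h1 := abs_sub_le (F ω).toReal (G ω) m.toReal
  have h2 := abs_sub_le (G ω) (∫ ω, G ω ∂π) m.toReal
  rw [abs_sub_comm (∫ ω, G ω ∂π)] at h2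
  change ε / 2 ≤ _
  linarith

end Conditioning

/-! ### The truncated volume and the part of the polyhedron over empty caps -/

/-- The volume of the part of `P ∆ D` inside the ball of radius `1 + h`. -/
def truncVol {n N : ℕ} (h : ℝ) (x : Fin N → Sph n) : ℝ :=
  volume.real ((poly x ∆ unitBall n) ∩ closedBall 0 (1 + h))

lemma measurable_truncVol (n N : ℕ) (h : ℝ) :
    Measurable fun x : Fin N → Sph n => truncVol h x :=
  (measurable_volume_symmDiff_inter n N isClosed_closedBall.measurableSet).ennreal_toReal

/-- The two polyhedra agree inside the ball of radius `1 + h` except in the caps cut off by the old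
and the new hyperplane. -/
lemma truncVol_le_add {d N : ℕ} {h : ℝ} (h0 : 0 ≤ h) (h1 : h ≤ 1) (ht : 1 - h ≤ tN (d + 1) N)
    {x x' : Fin N → Sph (d + 1)} {i : Fin N} (hx : ∀ j ≠ i, x' j = x j) :
    truncVol h x' ≤ truncVol h x + 2 * (2 * h * (4 * √h) ^ d) := by
  let cap : Sph (d + 1) → Set (EuclideanSpace ℝ (Fin (d + 1))) := fun u =>
    {y | ‖y‖ ≤ 1 + h ∧ tN (d + 1) N < inner ℝ (u : EuclideanSpace ℝ (Fin (d + 1))) y}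
  have hcap : ∀ u, volume.real (cap u) ≤ 2 * h * (4 * √h) ^ d := fun u =>
    ENNReal.toReal_le_of_le_ofReal (by positivity) (volume_cap_le u h0 h1 ht)
  have hcapfin : ∀ u, volume (cap u) ≠ ∞ := fun u =>
    ((volume_cap_le u h0 h1 ht).trans_lt ENNReal.ofReal_lt_top).ne
  have hball : volume ((poly x ∆ unitBall (d + 1)) ∩ closedBall 0 (1 + h)) ≠ ∞ :=
    ((measure_mono Set.inter_subset_right).trans_lt measure_closedBall_lt_top).ne
  have hsub : (poly x' ∆ unitBall (d + 1)) ∩ closedBall 0 (1 + h) ⊆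
      ((poly x ∆ unitBall (d + 1)) ∩ closedBall 0 (1 + h)) ∪ (cap (x i) ∪ cap (x' i)) := by
    rintro y ⟨hy, hyB⟩
    by_contra hcon
    simp only [Set.mem_union, not_or] at hcon
    obtain ⟨hc0, hc1, hc2⟩ := hcon
    have hyn : ‖y‖ ≤ 1 + h := by simpa using hyB
    have hiff : y ∈ poly x ↔ y ∈ poly x' := by
      simp only [poly, Set.mem_iInter]
      refine forall_congr' fun j => ?_
      rcases eq_or_ne j i with rfl | hj
      · exact iff_of_true (not_lt.mp fun hlt => hc1 ⟨hyn, hlt⟩)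
          (not_lt.mp fun hlt => hc2 ⟨hyn, hlt⟩)
      · rw [hx j hj]
    refine hc0 ⟨?_, hyB⟩
    rwa [Set.mem_symmDiff, hiff, ← Set.mem_symmDiff]
  calc truncVol h x' ≤ volume.real (((poly x ∆ unitBall (d + 1)) ∩ closedBall 0 (1 + h)) ∪
        (cap (x i) ∪ cap (x' i))) := measureReal_mono hsub
          (measure_union_ne_top hball (measure_union_ne_top (hcapfin _) (hcapfin _)))
    _ ≤ truncVol h x + (volume.real (cap (x i)) + volume.real (cap (x' i))) :=
        (measureReal_union_le _ _).trans (add_le_add le_rfl (measureReal_union_le _ _))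
    _ ≤ _ := by linarith [hcap (x i), hcap (x' i)]

lemma hasBoundedDifferences_truncVol {d N : ℕ} {h : ℝ} (h0 : 0 ≤ h) (h1 : h ≤ 1)
    (ht : 1 - h ≤ tN (d + 1) N) :
    HasBoundedDifferences (fun x : Fin N → Sph (d + 1) => truncVol h x)
      (2 * (2 * h * (4 * √h) ^ d)) := by
  intro x i s
  have hx : ∀ j ≠ i, Function.update x i s j = x j := fun j hj => Function.update_of_ne hj _ _
  have h2 := truncVol_le_add h0 h1 ht hx
  have h3 := truncVol_le_add h0 h1 ht (fun j hj => (hx j hj).symm)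
  rw [abs_le]
  constructor <;> linarith

/-- The points `v` of the net `V` whose cap of radius `s / 2` contains none of the points `x i`. -/
def emptyCaps {n N : ℕ} (V : Finset (Sph n)) (s : ℝ) (x : Fin N → Sph n) : Finset (Sph n) :=
  open Classical in V.filter fun v => ∀ i, x i ∉ closedBall v (s / 2)

lemma tN_le_one (n N : ℕ) : tN n N ≤ 1 :=
  Real.sqrt_le_one.mpr (by linarith [sq_nonneg (epsN n N)])

/-- Take `v` in the net within `s` of the direction of `y`. A normal within `s/2` of `v` would be
within `3s/2` of that direction, whereas `lt_dist_direction_sq` forces every normal to be farther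
than `2s`. -/
lemma exists_mem_emptyCaps {d N : ℕ} {V : Finset (Sph (d + 1))} {s : ℝ} (hs : 0 < s)
    (hs1 : 4 * s ^ 2 ≤ 1) (hV : ∀ u, ∃ v ∈ V, dist u v ≤ s) {x : Fin N → Sph (d + 1)}
    {y : EuclideanSpace ℝ (Fin (d + 1))} (hy : y ∈ poly x) (hys : 1 + 4 * s ^ 2 < ‖y‖) :
    ∃ v ∈ emptyCaps V s x, ‖‖y‖⁻¹ • y - v‖ ≤ s := by
  have hy0 : y ≠ 0 := norm_pos_iff.mp (by nlinarith)
  obtain ⟨v, hvV, hv⟩ := hV (direction hy0)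
  refine ⟨v, ?_, by rwa [Subtype.dist_eq, dist_eq_norm] at hv⟩
  simp only [emptyCaps, Finset.mem_filter]
  refine ⟨hvV, fun i hi => ?_⟩
  have h1 := lt_dist_direction_sq (tN_le_one _ _) (by positivity) hs1 hy hys i
  have h2 : dist (direction hy0) (x i) ≤ s + s / 2 := by
    refine (dist_triangle _ v _).trans (add_le_add hv ?_)
    rw [dist_comm]; exact hi
  rw [Subtype.dist_eq, dist_eq_norm] at h2
  change ‖‖y‖⁻¹ • y - x i‖ ≤ _ at h2
  nlinarith [norm_nonneg (‖y‖⁻¹ • y - x i)]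

lemma norm_le_of_emptyCaps_eq_empty {d N : ℕ} {V : Finset (Sph (d + 1))} {s : ℝ} (hs : 0 < s)
    (hs1 : 4 * s ^ 2 ≤ 1) (hV : ∀ u, ∃ v ∈ V, dist u v ≤ s) {x : Fin N → Sph (d + 1)}
    (hx : emptyCaps V s x = ∅) {y : EuclideanSpace ℝ (Fin (d + 1))} (hy : y ∈ poly x) :
    ‖y‖ ≤ 1 + 4 * s ^ 2 := by
  by_contra! hlt
  obtain ⟨v, hv, -⟩ := exists_mem_emptyCaps hs hs1 hV hy hlt
  simp [hx] at hv

lemma inside_of_emptyCaps_eq_empty {d N : ℕ} {V : Finset (Sph (d + 1))} {s : ℝ} (hs : 0 < s)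
    (hs1 : 4 * s ^ 2 ≤ 1) (hs2 : 4 * s ^ 2 ≤ 2 / ((d + 1 : ℕ) : ℝ))
    (hV : ∀ u, ∃ v ∈ V, dist u v ≤ s) {x : Fin N → Sph (d + 1)}
    (hx : emptyCaps V s x = ∅) : Inside x := by
  intro y hy
  rw [mem_closedBall, dist_zero_right]
  linarith [norm_le_of_emptyCaps_eq_empty hs hs1 hV hx hy]

lemma unitBall_subset_closedBall (n : ℕ) {r : ℝ} (hr : 1 ≤ r) : unitBall n ⊆ closedBall 0 r :=
  closedBall_subset_closedBall hr

/-- What truncation discards lies over the empty caps of scale `s`, and the absence of empty caps of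
scale `s'` bounds its height by `4 s'²`. Each sector has small base and small height; using two
scales keeps the base much smaller than the height would allow. -/
lemma abs_symmVol_sub_truncVol_le {d N : ℕ} {V V' : Finset (Sph (d + 1))} {s s' : ℝ} (hs : 0 < s)
    (hss' : s ≤ s') (hs1 : 4 * s' ^ 2 ≤ 1) (hV : ∀ u, ∃ v ∈ V, dist u v ≤ s)
    (hV' : ∀ u, ∃ v ∈ V', dist u v ≤ s') {x : Fin N → Sph (d + 1)}
    (hx : emptyCaps V' s' x = ∅) :
    |(symmVol x).toReal - truncVol (4 * s ^ 2) x|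
      ≤ (emptyCaps V s x).card * (2 * (4 * s' ^ 2) * (4 * s) ^ d) := by
  have hs' : 0 < s' := hs.trans_le hss'
  have hsq : s ^ 2 ≤ s' ^ 2 := by gcongr
  have hpoly : ∀ y ∈ poly x, ‖y‖ ≤ 1 + 4 * s' ^ 2 := fun y =>
    norm_le_of_emptyCaps_eq_empty hs' hs1 hV' hx
  let sec : Sph (d + 1) → Set (EuclideanSpace ℝ (Fin (d + 1))) := fun v =>
    {y | 1 ≤ ‖y‖ ∧ ‖y‖ ≤ 1 + 4 * s' ^ 2 ∧ ‖‖y‖⁻¹ • y - v‖ ≤ s}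
  have hsecle : ∀ v, volume (sec v) ≤ ENNReal.ofReal (2 * (4 * s' ^ 2) * (4 * s) ^ d) := fun v =>
    volume_sector_le v hs.le (by nlinarith) hs1
  have hsec : ∀ v, volume.real (sec v) ≤ 2 * (4 * s' ^ 2) * (4 * s) ^ d := fun v =>
    ENNReal.toReal_le_of_le_ofReal (by positivity) (hsecle v)
  have hsecfin : ∀ v, volume (sec v) < ∞ := fun v => (hsecle v).trans_lt ENNReal.ofReal_lt_top
  have hfin : volume (poly x ∆ unitBall (d + 1)) ≠ ∞ := by
    refine ((measure_mono (t := closedBall 0 (1 + 4 * s' ^ 2)) fun y hy => ?_).trans_lt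
      measure_closedBall_lt_top).ne
    rcases hy with hy | hy
    · simpa using hpoly y hy.1
    · exact unitBall_subset_closedBall _ (by nlinarith) hy.1
  have hle : truncVol (4 * s ^ 2) x ≤ (symmVol x).toReal :=
    measureReal_mono Set.inter_subset_left hfin
  have hsub : poly x ∆ unitBall (d + 1) ⊆
      ((poly x ∆ unitBall (d + 1)) ∩ closedBall 0 (1 + 4 * s ^ 2)) ∪
        ⋃ v ∈ emptyCaps V s x, sec v := by
    intro y hy
    by_cases hyB : ‖y‖ ≤ 1 + 4 * s ^ 2
    · exact Or.inl ⟨hy, by simpa using hyB⟩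
    · rw [not_le] at hyB
      rcases hy with hy | hy
      · obtain ⟨v, hv, hvs⟩ := exists_mem_emptyCaps hs (by linarith) hV hy.1 hyB
        exact Or.inr (Set.mem_biUnion hv ⟨by nlinarith, hpoly y hy.1, hvs⟩)
      · have : ‖y‖ ≤ 1 := by simpa [unitBall] using hy.1
        nlinarith
  have hge : (symmVol x).toReal ≤ truncVol (4 * s ^ 2) x +
      (emptyCaps V s x).card * (2 * (4 * s' ^ 2) * (4 * s) ^ d) := by
    calc (symmVol x).toReal ≤ volume.real (((poly x ∆ unitBall (d + 1)) ∩
            closedBall 0 (1 + 4 * s ^ 2)) ∪ ⋃ v ∈ emptyCaps V s x, sec v) := by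
          refine measureReal_mono hsub (measure_union_ne_top
            ((measure_mono Set.inter_subset_left).trans_lt hfin.lt_top).ne ?_)
          exact (measure_biUnion_lt_top (Finset.finite_toSet _) fun v _ => hsecfin v).ne
      _ ≤ truncVol (4 * s ^ 2) x + volume.real (⋃ v ∈ emptyCaps V s x, sec v) :=
          measureReal_union_le _ _
      _ ≤ truncVol (4 * s ^ 2) x + ∑ v ∈ emptyCaps V s x, volume.real (sec v) := by
          gcongr; exact measureReal_biUnion_finset_le _ _
      _ ≤ truncVol (4 * s ^ 2) x + ∑ v ∈ emptyCaps V s x, 2 * (4 * s' ^ 2) * (4 * s) ^ d := by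
          gcongr with v; exact hsec v
      _ = _ := by simp
  rw [abs_le]
  constructor
  · have : (0 : ℝ) ≤ (emptyCaps V s x).card * (2 * (4 * s' ^ 2) * (4 * s) ^ d) := by positivity
    linarith
  · linarith

/-! ### Deviation inequality at given scales -/

/-- A probability measure on the sphere that charges every cap of radius `s ≤ 1` at least as much
as `a s^d`. -/
def ChargesCaps {d : ℕ} (μ : Measure (Sph (d + 1))) (a : ℝ) : Prop :=
  ∀ u, ∀ s, 0 < s → s ≤ 1 → a * s ^ d ≤ μ.real (closedBall u s)

lemma exists_net_emptyCaps {d : ℕ} {μ : Measure (Sph (d + 1))} [IsProbabilityMeasure μ] {a : ℝ}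
    (ha : 0 < a) (hμ : ChargesCaps μ a) {s : ℝ} (hs : 0 < s) (hs1 : s ≤ 1) :
    ∃ V : Finset (Sph (d + 1)), (∀ u, ∃ v ∈ V, dist u v ≤ s) ∧
      ∀ N k : ℕ, (Measure.pi fun _ : Fin N => μ).real {x | k ≤ (emptyCaps V s x).card}
        ≤ (1 / (a * (s / 2) ^ d)) ^ k * Real.exp (-(N * (k * (a * (s / 2) ^ d)))) := by
  have hp : 0 < a * (s / 2) ^ d := by positivity
  have hcap : ∀ u, a * (s / 2) ^ d ≤ μ.real (closedBall u (s / 2)) := fun u =>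
    hμ u _ (by positivity) (by linarith)
  obtain ⟨V, hnet, hdisj, hcard⟩ := exists_separated_net μ hs hp hcap
  refine ⟨V, hnet, fun N k => ?_⟩
  refine (measureReal_card_empty_ge_le μ N k V (fun v => closedBall v (s / 2))
    (fun v => isClosed_closedBall.measurableSet) hdisj hcap (emptyCaps V s)
    fun x v hv => ?_).trans ?_
  · simpa [emptyCaps] using hv
  · gcongr
    rwa [le_div_iff₀ hp]

lemma measureReal_not_inside_le {d : ℕ} {μ : Measure (Sph (d + 1))} [IsProbabilityMeasure μ] {a : ℝ}
    (ha : 0 < a) (hμ : ChargesCaps μ a) {s : ℝ} (hs : 0 < s) (hs1 : 4 * s ^ 2 ≤ 1)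
    (hs2 : 4 * s ^ 2 ≤ 2 / ((d + 1 : ℕ) : ℝ)) (N : ℕ) :
    (Measure.pi fun _ : Fin N => μ).real {x | ¬ Inside x}
      ≤ 1 / (a * (s / 2) ^ d) * Real.exp (-(N * (a * (s / 2) ^ d))) := by
  obtain ⟨V, hV, hprob⟩ := exists_net_emptyCaps ha hμ hs (by nlinarith)
  have := hprob N 1
  rw [pow_one, Nat.cast_one, one_mul] at this
  refine (measureReal_mono fun x hx => ?_).trans this
  by_contra hcard
  refine hx (inside_of_emptyCaps_eq_empty hs hs1 hs2 hV (Finset.card_eq_zero.mp ?_))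
  exact Nat.lt_one_iff.mp (not_le.mp hcard)

/-- Deviation inequality at given scales `s ≤ s'`: the truncated volume is controlled by bounded
differences, and the remainder by the numbers of empty caps of radii `s` and `s'`. -/
theorem measureReal_symmVol_deviation_le {d : ℕ} (hd : 1 ≤ d) {μ : Measure (Sph (d + 1))}
    [IsProbabilityMeasure μ] {a : ℝ} (ha : 0 < a) (hμ : ChargesCaps μ a) {s s' δ : ℝ} (hs : 0 < s)
    (hss' : s ≤ s') (hs1 : 4 * s' ^ 2 ≤ 1) (hs2 : 4 * s' ^ 2 ≤ 2 / ((d + 1 : ℕ) : ℝ)) (N k : ℕ)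
    (ht : 1 - 4 * s ^ 2 ≤ tN (d + 1) N)
    (hδ : (1 / (a * (s / 2) ^ d)) ^ k * Real.exp (-(N * (k * (a * (s / 2) ^ d)))) +
      1 / (a * (s' / 2) ^ d) * Real.exp (-(N * (a * (s' / 2) ^ d))) ≤ δ) (hδ2 : δ ≤ 1 / 2)
    {ε : ℝ} (hε : 4 * (k * (8 * s' ^ 2 * (4 * s) ^ d)) +
      6 * volume.real (closedBall (0 : EuclideanSpace ℝ (Fin (d + 1))) 2) * δ ≤ ε) :
    (Measure.pi fun _ : Fin N => μ).real {x | ENNReal.ofReal ε ≤ absSub (symmVol x)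
        (∫⁻ x, symmVol x ∂(ProbabilityTheory.cond (Measure.pi fun _ : Fin N => μ) {x | Inside x}))}
      ≤ 2 * Real.exp (-(ε / 2) ^ 2 / (2 * (N * (16 * s ^ 2 * (8 * s) ^ d) ^ 2))) + δ := by
  have hs' : 0 < s' := hs.trans_le hss'
  have hsq : s ^ 2 ≤ s' ^ 2 := by gcongr
  obtain ⟨V, hV, hprob⟩ := exists_net_emptyCaps ha hμ hs (by nlinarith)
  obtain ⟨V', hV', hprob'⟩ := exists_net_emptyCaps ha hμ hs' (by nlinarith)
  set π := Measure.pi fun _ : Fin N => μ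
  set C := volume.real (closedBall (0 : EuclideanSpace ℝ (Fin (d + 1))) 2)
  set bad : Set (Fin N → Sph (d + 1)) :=
    {x | k ≤ (emptyCaps V s x).card} ∪ {x | 1 ≤ (emptyCaps V' s' x).card}
  -- The measurable hull has the same mass, so measurability of the counts of empty caps is not
  -- needed.
  have hbad : π.real (toMeasurable π bad) ≤ δ := by
    rw [measureReal_def, measure_toMeasurable, ← measureReal_def]
    refine (measureReal_union_le _ _).trans ((add_le_add (hprob N k) (hprob' N 1)).trans ?_)
    simpa using hδ
  have hδ0 : 0 ≤ δ := measureReal_nonneg.trans hbad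
  have hε0 : 0 ≤ ε := le_trans (by positivity) hε
  have hh : √(4 * s ^ 2) = 2 * s := by
    rw [show 4 * s ^ 2 = (2 * s) ^ 2 by ring, Real.sqrt_sq (by positivity)]
  have hbd := hasBoundedDifferences_truncVol (d := d) (N := N) (h := 4 * s ^ 2) (by positivity)
    (by linarith) ht
  rw [hh] at hbd
  have hconc := measureReal_abs_sub_integral_ge_le μ (measurable_truncVol (d + 1) N (4 * s ^ 2))
    (by positivity) hbd (ε := ε / 2) (by positivity)
  have hC2 : ∀ A : Set (EuclideanSpace ℝ (Fin (d + 1))), A ⊆ closedBall 0 2 →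
      volume A ≤ ENNReal.ofReal C := fun A hA => by
    rw [ofReal_measureReal measure_closedBall_lt_top.ne]
    exact measure_mono hA
  have hmain := measureReal_deviation_le (π := π) (F := fun x => symmVol x)
    (G := fun x => truncVol (4 * s ^ 2) x) (W := {x | Inside x}) (A := toMeasurable π bad)
    (C := C) (q := k * (8 * s' ^ 2 * (4 * s) ^ d)) (δ := δ) (ε := ε)
    (measurable_symmVol _ _) (measurable_truncVol _ _ _) (measurableSet_inside _ _)
    (measurableSet_toMeasurable _ _) (fun _ => measureReal_nonneg) (fun x => ?_) (fun x hx => ?_)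
    measureReal_nonneg (by positivity) (fun x hx => ?_) hbad hδ2 (by linarith)
  · refine hmain.trans (add_le_add (hconc.trans_eq ?_) le_rfl)
    congr 6; ring
  · refine measureReal_mono (Set.inter_subset_right.trans
      (closedBall_subset_closedBall (by linarith))) measure_closedBall_lt_top.ne
  · refine hC2 _ ?_
    -- Since `n ≥ 2`, the radius `1 + 2/n` is at most `2`, and the volume of the ball of radius 2
    -- serves as the common bound `C`.
    have hd2 : 2 / ((d + 1 : ℕ) : ℝ) ≤ 1 := by
      rw [div_le_one (by positivity)]
      exact_mod_cast Nat.succ_le_succ hd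
    intro y hy
    rcases hy with hy | hy
    · exact closedBall_subset_closedBall (by linarith) (hx hy.1)
    · exact unitBall_subset_closedBall _ (by norm_num) hy.1
  · have hx' : x ∉ bad := fun h => hx (subset_toMeasurable _ _ h)
    simp only [bad, Set.mem_union, Set.mem_ofPred_eq, not_or, not_le, Nat.lt_one_iff,
      Finset.card_eq_zero] at hx'
    obtain ⟨hx1, hx2⟩ := hx'
    refine ⟨inside_of_emptyCaps_eq_empty hs' hs1 hs2 hV' hx2,
      (abs_symmVol_sub_truncVol_le hs hss' hs1 hV hV' hx2).trans ?_⟩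
    calc ((emptyCaps V s x).card : ℝ) * (2 * (4 * s' ^ 2) * (4 * s) ^ d)
        ≤ k * (2 * (4 * s' ^ 2) * (4 * s) ^ d) := by gcongr
      _ = _ := by ring

/-! ### Densities on the sphere and transfer to independent random points -/

lemma surface_univ_pos (d : ℕ) : 0 < (surface (d + 1)).real Set.univ := by
  rw [surface, Measure.toSphere_real_apply_univ]
  have : 0 < (volume : Measure (EuclideanSpace ℝ (Fin (d + 1)))).real (ball 0 1) :=
    ENNReal.toReal_pos (measure_ball_pos _ _ one_pos).ne' measure_ball_lt_top.ne
  simp only [finrank_euclideanSpace, Fintype.card_fin]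
  positivity

lemma volume_unitBall_pos (n : ℕ) : 0 < volume.real (unitBall n) :=
  ENNReal.toReal_pos (measure_closedBall_pos _ _ one_pos).ne' measure_closedBall_lt_top.ne

instance (n : ℕ) : IsFiniteMeasure (surface n) :=
  inferInstanceAs (IsFiniteMeasure (Measure.toSphere _))

instance (d : ℕ) : IsProbabilityMeasure (sigma (d + 1)) := by
  refine ⟨?_⟩
  have h : surface (d + 1) Set.univ ≠ 0 := fun h => by
    have := surface_univ_pos d
    rw [measureReal_def, h] at this
    simp at this
  simp [sigma, ENNReal.inv_mul_cancel h (measure_ne_top _ _)]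

lemma withDens_one (n : ℕ) : withDens n (fun _ => 1) = sigma n := by
  simp [withDens]

/-- By compactness `g` attains a positive minimum, which reduces the claim to the lower bound for
the surface measure of caps. -/
lemma exists_chargesCaps_withDens {d : ℕ} (hd : 1 ≤ d) {g : Sph (d + 1) → ℝ} (hg : Continuous g)
    (hpos : ∀ x, 0 < g x) (hp : IsProbabilityMeasure (withDens (d + 1) g)) :
    ∃ a, 0 < a ∧ ChargesCaps (withDens (d + 1) g) a := by
  have hne : Nonempty (Sph (d + 1)) :=
    nonempty_of_isProbabilityMeasure (sigma (d + 1))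
  obtain ⟨x₀, hx₀⟩ := hg.exists_forall_le_of_hasCompactSupport
    (HasCompactSupport.of_compactSpace g)
  have hS := surface_univ_pos d
  set S := (surface (d + 1)).real Set.univ with hSdef
  have hd' : (0 : ℝ) < d := by exact_mod_cast hd
  refine ⟨g x₀ * (S⁻¹ * (1 / 4 * (1 / (2 * d)) ^ d)), mul_pos (hpos _) (by positivity),
    fun u s hs hs1 => ?_⟩
  rw [measureReal_def, ← ENNReal.ofReal_le_iff_le_toReal (measure_ne_top _ _), withDens,
    withDensity_apply _ isClosed_closedBall.measurableSet]
  calc ENNReal.ofReal (g x₀ * (S⁻¹ * (1 / 4 * (1 / (2 * d)) ^ d)) * s ^ d)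
      = ENNReal.ofReal (g x₀) * (ENNReal.ofReal S⁻¹ *
          ENNReal.ofReal (1 / 4 * (s / (2 * d)) ^ d)) := by
        rw [← ENNReal.ofReal_mul (by positivity), ← ENNReal.ofReal_mul (hpos _).le]
        congr 1
        rw [div_pow, div_pow]; ring
    _ ≤ ENNReal.ofReal (g x₀) * sigma (d + 1) (closedBall u s) := by
        gcongr
        rw [sigma, Measure.smul_apply, smul_eq_mul]
        refine mul_le_mul' (le_of_eq ?_) (surface_closedBall_ge hd u hs hs1)
        rw [ENNReal.ofReal_inv_of_pos hS, hSdef, ofReal_measureReal (measure_ne_top _ _)]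
    _ = ∫⁻ _ in closedBall u s, ENNReal.ofReal (g x₀) ∂sigma (d + 1) := by simp
    _ ≤ _ := lintegral_mono fun x => ENNReal.ofReal_le_ofReal (hx₀ x)

lemma IsIID.map_eq {n N : ℕ} {Ω : Type*} [MeasurableSpace Ω] {Pr : Measure Ω}
    [IsProbabilityMeasure Pr] {X : Fin N → Ω → Sph n} {μ : Measure (Sph n)} (h : IsIID Pr X μ) :
    Pr.map (fun ω i => X i ω) = Measure.pi fun _ => μ := by
  rw [(iIndepFun_iff_map_fun_eq_pi_map fun i => (h.measurable i).aemeasurable).1 h.indep]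
  simp [h.law]

section Transfer

variable {n N : ℕ} {Ω : Type*} [MeasurableSpace Ω] {Pr : Measure Ω} [IsProbabilityMeasure Pr]
  {X : Fin N → Ω → Sph n} {μ : Measure (Sph n)}

lemma IsIID.measureReal_eq (h : IsIID Pr X μ) {A : Set (Fin N → Sph n)} (hA : MeasurableSet A) :
    Pr.real {ω | (fun i => X i ω) ∈ A} = (Measure.pi fun _ => μ).real A := by
  rw [← h.map_eq, map_measureReal_apply (measurable_pi_lambda _ h.measurable) hA]
  rfl

lemma IsIID.condMean_eq (h : IsIID Pr X μ) : condMean Pr X =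
    ∫⁻ x, symmVol x ∂(ProbabilityTheory.cond (Measure.pi fun _ : Fin N => μ) {x | Inside x}) := by
  have hX : Measurable fun ω i => X i ω := measurable_pi_lambda _ h.measurable
  have hW := measurableSet_inside n N
  rw [condMean, ProbabilityTheory.cond, ProbabilityTheory.cond, lintegral_smul_measure,
    lintegral_smul_measure, ← h.map_eq, Measure.map_apply hX hW,
    setLIntegral_map hW (measurable_symmVol n N) hX]
  rfl

end Transfer

/-! ### Choice of scales and orders of magnitude -/

/-- The order of magnitude of the fluctuations of the volume. -/
def fluct (d N : ℕ) : ℝ := √N * (Real.log N / N) ^ (1 + 2 / (d : ℝ))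

/-- The scale of caps whose measure is of order `z`. -/
def capScale (d : ℕ) (z : ℝ) : ℝ := 2 * z ^ (1 / (d : ℝ))

/-- The number of empty small caps that is unlikely to be exceeded. -/
def numCaps (d N : ℕ) : ℕ := ⌈(N : ℝ) ^ ((d : ℝ) / (2 * (d + 2)))⌉₊

lemma capScale_half_pow {d : ℕ} (hd : 1 ≤ d) {z : ℝ} (hz : 0 ≤ z) :
    (capScale d z / 2) ^ d = z := by
  have hd0 : (d : ℝ) ≠ 0 := by positivity
  rw [capScale, mul_div_cancel_left₀ _ two_ne_zero, ← Real.rpow_natCast, ← Real.rpow_mul hz,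
    one_div_mul_cancel hd0, Real.rpow_one]

lemma capScale_pow {d : ℕ} (hd : 1 ≤ d) {z : ℝ} (hz : 0 ≤ z) : capScale d z ^ d = 2 ^ d * z := by
  conv_rhs => rw [← capScale_half_pow hd hz]
  rw [← mul_pow, mul_div_cancel₀ _ two_ne_zero]

lemma capScale_sq {d : ℕ} {z : ℝ} (hz : 0 ≤ z) :
    capScale d z ^ 2 = 4 * z ^ (2 / (d : ℝ)) := by
  rw [capScale, mul_pow, ← Real.rpow_natCast (z ^ _), ← Real.rpow_mul hz]
  congr 2
  · norm_num
  · push_cast; ring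

lemma capScale_mono {d : ℕ} {z w : ℝ} (hz : 0 ≤ z) (hzw : z ≤ w) : capScale d z ≤ capScale d w := by
  unfold capScale
  gcongr

lemma cap_volume_eq {d : ℕ} (hd : 1 ≤ d) {z : ℝ} (hz : 0 < z) :
    16 * capScale d z ^ 2 * (8 * capScale d z) ^ d
      = 64 * 16 ^ d * z ^ (1 + 2 / (d : ℝ)) := by
  rw [mul_pow, capScale_pow hd hz.le, capScale_sq hz.le, Real.rpow_add hz, Real.rpow_one,
    show (16 : ℝ) ^ d = 8 ^ d * 2 ^ d by rw [← mul_pow]; norm_num]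
  ring

lemma sector_volume_eq {d : ℕ} (hd : 1 ≤ d) {z k : ℝ} (hz : 0 < z) (hk : 0 < k) :
    k * (8 * capScale d (k * z) ^ 2 * (4 * capScale d z) ^ d)
      = 32 * 8 ^ d * k ^ (1 + 2 / (d : ℝ)) * z ^ (1 + 2 / (d : ℝ)) := by
  rw [mul_pow, capScale_pow hd hz.le, capScale_sq (by positivity), Real.mul_rpow hk.le hz.le,
    Real.rpow_add hz, Real.rpow_add hk, Real.rpow_one, Real.rpow_one,
    show (8 : ℝ) ^ d = 4 ^ d * 2 ^ d by rw [← mul_pow]; norm_num]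
  ring

lemma one_le_numCaps (d : ℕ) {N : ℕ} (hN : 1 ≤ N) : 1 ≤ numCaps d N :=
  Nat.one_le_ceil_iff.mpr (by positivity)

lemma numCaps_le (d : ℕ) {N : ℕ} (hN : 1 ≤ N) :
    (numCaps d N : ℝ) ≤ 2 * (N : ℝ) ^ ((d : ℝ) / (2 * (d + 2))) := by
  have hN' : (1 : ℝ) ≤ N := by exact_mod_cast hN
  have h1 : (1 : ℝ) ≤ (N : ℝ) ^ ((d : ℝ) / (2 * (d + 2))) :=
    Real.one_le_rpow hN' (by positivity)
  have := Nat.ceil_lt_add_one (a := (N : ℝ) ^ ((d : ℝ) / (2 * (d + 2)))) (by positivity)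
  unfold numCaps
  linarith

/-- The exponent in `numCaps` solves `d/(2(d+2)) · (1 + 2/d) = 1/2`, so that the discarded volume
has the order of the McDiarmid fluctuation. -/
lemma numCaps_rpow_le {d : ℕ} (hd : 1 ≤ d) {N : ℕ} (hN : 1 ≤ N) :
    (numCaps d N : ℝ) ^ (1 + 2 / (d : ℝ)) ≤ 2 ^ (1 + 2 / (d : ℝ)) * √N := by
  have hd0 : (0 : ℝ) < d := by exact_mod_cast hd
  calc _ ≤ (2 * (N : ℝ) ^ ((d : ℝ) / (2 * (d + 2)))) ^ (1 + 2 / (d : ℝ)) :=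
        Real.rpow_le_rpow (by positivity) (numCaps_le d hN) (by positivity)
    _ = _ := by
        rw [Real.mul_rpow (by norm_num) (by positivity), ← Real.rpow_mul (by positivity),
          Real.sqrt_eq_rpow]
        congr 2
        field_simp

lemma numCaps_le_sqrt (d : ℕ) {N : ℕ} (hN : 1 ≤ N) : (numCaps d N : ℝ) ≤ 2 * √N := by
  have hN' : (1 : ℝ) ≤ N := by exact_mod_cast hN
  refine (numCaps_le d hN).trans ?_
  rw [Real.sqrt_eq_rpow]
  refine mul_le_mul_of_nonneg_left (Real.rpow_le_rpow_of_exponent_le hN' ?_) (by norm_num)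
  rw [div_le_div_iff₀ (by positivity) (by norm_num)]
  linarith

/-- This places `exp(-3kL)` below the second term of the tail bound. The gap between the exponents
is `(d+4)/(d(d+2))`. -/
lemma rpow_le_numCaps {d : ℕ} (hd : 1 ≤ d) {N : ℕ} (hN : 1 ≤ N) :
    (N : ℝ) ^ (1 / 2 - 2 / (d : ℝ)) ≤ numCaps d N := by
  have hN' : (1 : ℝ) ≤ N := by exact_mod_cast hN
  have hd0 : (0 : ℝ) < d := by exact_mod_cast hd
  refine le_trans ?_ (Nat.le_ceil _)
  refine Real.rpow_le_rpow_of_exponent_le hN' ?_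
  have : (d : ℝ) / (2 * (d + 2)) - (1 / 2 - 2 / (d : ℝ)) = (d + 4) / (d * (d + 2)) := by
    field_simp; ring
  have h2 : 0 ≤ ((d : ℝ) + 4) / (d * (d + 2)) := by positivity
  linarith

lemma fluct_pos {d N : ℕ} (hN : 2 ≤ N) : 0 < fluct d N := by
  have h2 : (1 : ℝ) < N := by exact_mod_cast hN
  have := Real.log_pos h2
  unfold fluct
  positivity

lemma rpow_mul_fN_eq {d N : ℕ} (hN : 2 ≤ N) :
    (N : ℝ) ^ (1 + 4 / (((d + 1 : ℕ) : ℝ) - 1)) * fN (d + 1) N = 1 / fluct d N ^ 2 := by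
  have h2 : (1 : ℝ) < N := by exact_mod_cast hN
  have hN0 : (0 : ℝ) < N := by linarith
  have hL := Real.log_pos h2
  have hn : ((d + 1 : ℕ) : ℝ) - 1 = d := by push_cast; ring
  rw [fN, hn, fluct, mul_pow, Real.sq_sqrt hN0.le, ← Real.rpow_natCast (_ ^ _),
    ← Real.rpow_mul (by positivity), Real.div_rpow hL.le hN0.le, Real.rpow_neg hL.le]
  have he : (1 + 2 / (d : ℝ)) * (2 : ℕ) = 2 + 4 / d := by push_cast; ring
  have he2 : (2 + 4 / (d : ℝ)) = 1 + (1 + 4 / d) := by ring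
  rw [he]
  have hNN : (N : ℝ) ^ (2 + 4 / (d : ℝ)) = N * (N : ℝ) ^ (1 + 4 / (d : ℝ)) := by
    rw [he2, Real.rpow_add hN0, Real.rpow_one]
  rw [hNN]
  field_simp

/-- The power 3 suffices since `1 + 2/d ≤ 3`. Hence the exceptional probability contributes to the
mean no more than the order of `fluct`. -/
lemma exp_neg_three_log_le_fluct {d : ℕ} (hd : 1 ≤ d) {N : ℕ} (hN : 2 ≤ N)
    (hlog : 1 ≤ Real.log N) : Real.exp (-(3 * Real.log N)) ≤ fluct d N := by
  have h2 : (1 : ℝ) < N := by exact_mod_cast hN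
  have hN0 : (0 : ℝ) < N := by linarith
  have hd0 : (1 : ℝ) ≤ d := by exact_mod_cast hd
  have hd2 : 2 / (d : ℝ) ≤ 2 := by rw [div_le_iff₀ (by linarith)]; linarith
  calc Real.exp (-(3 * Real.log N)) = (1 / N : ℝ) ^ (3 : ℝ) := by
        rw [Real.rpow_def_of_pos (by positivity), one_div, Real.log_inv]; congr 1; ring
    _ ≤ (1 / N : ℝ) ^ (1 + 2 / (d : ℝ)) := by
        refine Real.rpow_le_rpow_of_exponent_ge (by positivity) ?_ (by linarith)
        rw [div_le_one hN0]; exact h2.le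
    _ ≤ (Real.log N / N) ^ (1 + 2 / (d : ℝ)) := by gcongr
    _ ≤ fluct d N := by
        unfold fluct
        refine le_mul_of_one_le_left (by positivity) ?_
        rw [Real.one_le_sqrt]; exact h2.le

lemma one_sub_le_tN {d N : ℕ} {s : ℝ} (hs1 : 4 * s ^ 2 ≤ 1) (h0 : 0 ≤ epsN (d + 1) N)
    (h : epsN (d + 1) N ≤ s) : 1 - 4 * s ^ 2 ≤ tN (d + 1) N := by
  have hsq : epsN (d + 1) N ^ 2 ≤ s ^ 2 := by gcongr
  refine Real.le_sqrt_of_sq_le ?_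
  nlinarith [sq_nonneg (epsN (d + 1) N)]

/-- The probability of the exceptional event at the scales used in the proof. -/
lemma bad_prob_le {N : ℕ} (hN : 2 ≤ N) (hlog : 1 ≤ Real.log N) {k : ℕ} (hk : 1 ≤ k) :
    (1 / (5 * Real.log N / N)) ^ k * Real.exp (-(N * (k * (5 * Real.log N / N)))) +
      1 / (k * (5 * Real.log N / N)) * Real.exp (-(N * (k * (5 * Real.log N / N))))
      ≤ Real.exp (-(3 * (k * Real.log N))) := by
  have h2 : (1 : ℝ) < N := by exact_mod_cast hN
  have hN0 : (0 : ℝ) < N := by linarith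
  have hk' : (1 : ℝ) ≤ k := by exact_mod_cast hk
  set L := Real.log N with hL
  have hexpL : Real.exp L = N := Real.exp_log hN0
  have hp : 1 / (5 * L / N) ≤ Real.exp L := by
    rw [hexpL, one_div_div, div_le_iff₀ (by linarith)]; nlinarith
  have hp' : 1 / (k * (5 * L / N)) ≤ Real.exp (k * L) := by
    have h3 : Real.exp L ≤ Real.exp (k * L) := Real.exp_le_exp.mpr (by nlinarith)
    refine le_trans ?_ (hp.trans h3)
    apply one_div_le_one_div_of_le (by positivity)
    exact le_mul_of_one_le_left (by positivity) hk'
  have hpk : (1 / (5 * L / N)) ^ k ≤ Real.exp (k * L) := by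
    rw [Real.exp_nat_mul]
    exact pow_le_pow_left₀ (by positivity) hp k
  have hexp : N * (k * (5 * L / N)) = 5 * (k * L) := by field_simp
  rw [hexp]
  have hkL : 1 ≤ k * L := by nlinarith
  have htwo : 2 ≤ Real.exp (k * L) := by linarith [Real.add_one_le_exp (k * L)]
  -- Of the exponent `5kL`, one `kL` pays for the number of families of caps and one for the factor
  -- 2, leaving `3kL`.
  calc _ ≤ Real.exp (k * L) * Real.exp (-(5 * (k * L))) +
        Real.exp (k * L) * Real.exp (-(5 * (k * L))) := by gcongr
    _ = 2 * Real.exp (-(4 * (k * L))) := by rw [← Real.exp_add, ← two_mul]; ring_nf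
    _ ≤ Real.exp (k * L) * Real.exp (-(4 * (k * L))) := by gcongr
    _ = _ := by rw [← Real.exp_add]; ring_nf

lemma tendsto_numCaps_mul_log_div (d : ℕ) :
    Filter.Tendsto (fun N : ℕ => (numCaps d N : ℝ) * (Real.log N / N)) Filter.atTop (nhds 0) := by
  have h : Filter.Tendsto (fun N : ℕ => 2 * (Real.log (N : ℝ) / (N : ℝ) ^ (1 / 2 : ℝ)))
      Filter.atTop (nhds 0) := by
    have := (isLittleO_log_rpow_atTop (r := 1 / 2) (by norm_num)).tendsto_div_nhds_zero
    simpa using (this.comp tendsto_natCast_atTop_atTop).const_mul 2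
  refine squeeze_zero' (Filter.Eventually.of_forall fun N => ?_) ?_ h
  · exact mul_nonneg (by positivity) (div_nonneg (Real.log_natCast_nonneg N) (by positivity))
  · filter_upwards [Filter.eventually_ge_atTop 1] with N hN
    have hN0 : (0 : ℝ) < N := by exact_mod_cast hN
    have hL := Real.log_natCast_nonneg N
    calc _ ≤ 2 * √N * (Real.log N / N) := by gcongr; exact numCaps_le_sqrt d hN
      _ = _ := by
        rw [← Real.sqrt_eq_rpow]
        have := Real.sqrt_div_self' (x := N)
        linear_combination 2 * Real.log N * this

lemma eventually_measureReal_inside_ge {d : ℕ} {μ : Measure (Sph (d + 1))}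
    [IsProbabilityMeasure μ] {a : ℝ} (ha : 0 < a) (hμ : ChargesCaps μ a) :
    ∃ c, 0 < c ∧ ∀ᶠ N : ℕ in Filter.atTop,
      1 - Real.exp (-(c * N)) ≤ (Measure.pi fun _ : Fin N => μ).real {x | Inside x} := by
  have hd1 : (1 : ℝ) ≤ ((d + 1 : ℕ) : ℝ) := by exact_mod_cast Nat.succ_le_succ (Nat.zero_le d)
  -- A scale independent of `N` is enough here: `4 s² = 1/n²` is below both `1` and `2/n`, and one
  -- cap of fixed mass is empty with exponentially small probability.
  set s : ℝ := 1 / (2 * ((d + 1 : ℕ) : ℝ)) with hs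
  have hs0 : 0 < s := by positivity
  have hs2 : 4 * s ^ 2 = 1 / ((d + 1 : ℕ) : ℝ) ^ 2 := by rw [hs]; field_simp; norm_num
  have hs2' : 4 * s ^ 2 ≤ 1 / ((d + 1 : ℕ) : ℝ) := by
    rw [hs2]
    exact one_div_le_one_div_of_le (by positivity) (by nlinarith)
  have hs1 : 4 * s ^ 2 ≤ 1 := hs2'.trans (by rw [div_le_one (by positivity)]; exact hd1)
  have hs3 : 4 * s ^ 2 ≤ 2 / ((d + 1 : ℕ) : ℝ) := hs2'.trans (by gcongr; norm_num)
  set p := a * (s / 2) ^ d with hp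
  have hp0 : 0 < p := by positivity
  refine ⟨p / 2, by positivity, ?_⟩
  have htend : Filter.Tendsto (fun N : ℕ => Real.exp (p / 2 * N)) Filter.atTop Filter.atTop :=
    Real.tendsto_exp_atTop.comp (tendsto_natCast_atTop_atTop.const_mul_atTop (by positivity))
  filter_upwards [htend.eventually_ge_atTop (1 / p)] with N hN
  have h1 := measureReal_not_inside_le ha hμ hs0 hs1 hs3 N
  have h2 : (Measure.pi fun _ : Fin N => μ).real {x | ¬ Inside x} =
      1 - (Measure.pi fun _ : Fin N => μ).real {x | Inside x} :=
    probReal_compl_eq_one_sub (measurableSet_inside _ _)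
  have h3 : 1 / p * Real.exp (-(N * p)) ≤ Real.exp (-(p / 2 * N)) := by
    calc _ ≤ Real.exp (p / 2 * N) * Real.exp (-(N * p)) := by gcongr
      _ = _ := by rw [← Real.exp_add]; congr 1; ring
  linarith

lemma tailBound_eq {d N : ℕ} (hN : 2 ≤ N) (c ε : ℝ) :
    tailBound (d + 1) N c 1 ε = 2 * Real.exp (-(c * (1 / fluct d N ^ 2) * ε ^ 2)) +
      Real.exp (-(Real.log N * (N : ℝ) ^ (1 / 2 - 2 / (d : ℝ)))) := by
  rw [tailBound, ← rpow_mul_fN_eq hN, one_mul, mul_assoc c,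
    show 1 / 2 - 2 / (((d + 1 : ℕ) : ℝ) - 1) = 1 / 2 - 2 / (d : ℝ) by
      rw [Nat.cast_succ, add_sub_cancel_right]]

/-- The constant `1/(8A² + 2B²)` is at most both `1/(8A²)`, required here by McDiarmid, and
`1/(2B²)`, required in `one_le_two_mul_exp`. -/
lemma gaussian_exponent_le {A B b : ℝ} (hA : 0 < A) (hb : 0 < b) (ε : ℝ) :
    -(ε / 2) ^ 2 / (2 * (A ^ 2 * b ^ 2)) ≤ -(1 / (8 * A ^ 2 + 2 * B ^ 2) * (1 / b ^ 2) * ε ^ 2) := by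
  rw [neg_div, neg_le_neg_iff]
  calc 1 / (8 * A ^ 2 + 2 * B ^ 2) * (1 / b ^ 2) * ε ^ 2
      ≤ 1 / (8 * A ^ 2) * (1 / b ^ 2) * ε ^ 2 := by
        gcongr; nlinarith [sq_nonneg B]
    _ = _ := by field_simp; ring

/-- For `ε ≤ B b` the exponent is at least `-1/2`, so the right-hand side of the tail bound is at
least 1 and there is nothing to prove. -/
lemma one_le_two_mul_exp {A B b ε : ℝ} (hB : 0 < B) (hb : 0 < b) (hε : 0 ≤ ε) (hεB : ε ≤ B * b) :
    1 ≤ 2 * Real.exp (-(1 / (8 * A ^ 2 + 2 * B ^ 2) * (1 / b ^ 2) * ε ^ 2)) := by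
  have h1 : 1 / (8 * A ^ 2 + 2 * B ^ 2) * (1 / b ^ 2) * ε ^ 2 ≤ 1 / 2 := by
    calc _ ≤ 1 / (2 * B ^ 2) * (1 / b ^ 2) * (B * b) ^ 2 := by
          gcongr; nlinarith [sq_nonneg A]
      _ = _ := by field_simp
  linarith [Real.add_one_le_exp (-(1 / (8 * A ^ 2 + 2 * B ^ 2) * (1 / b ^ 2) * ε ^ 2))]

lemma epsN_eq (d N : ℕ) : epsN (d + 1) N =
    ((surface (d + 1)).real Set.univ / volume.real (unitBall d) / N) ^ (1 / (d : ℝ)) := by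
  unfold epsN
  congr 1
  · rw [div_div, mul_comm (volume.real _)]; rfl
  · push_cast; ring

lemma eventually_deviation_le {d : ℕ} (hd : 1 ≤ d) {μ : Measure (Sph (d + 1))}
    [IsProbabilityMeasure μ] {a : ℝ} (ha : 0 < a) (hμ : ChargesCaps μ a) :
    ∃ c, 0 < c ∧ ∀ᶠ N : ℕ in Filter.atTop, ∀ ε : ℝ, 0 < ε →
      (Measure.pi fun _ : Fin N => μ).real {x | ENNReal.ofReal ε ≤ absSub (symmVol x)
        (∫⁻ x, symmVol x ∂(ProbabilityTheory.cond (Measure.pi fun _ : Fin N => μ) {x | Inside x}))}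
      ≤ tailBound (d + 1) N c 1 ε := by
  have hd0 : (0 : ℝ) < d := by exact_mod_cast hd
  have hd1 : (1 : ℝ) ≤ ((d + 1 : ℕ) : ℝ) := by exact_mod_cast Nat.succ_le_succ (Nat.zero_le d)
  set γ : ℝ := 1 + 2 / (d : ℝ) with hγ
  -- Chosen so that `z = κ L/N` satisfies `a z = 5L/N`, the lower bound for the mass of a cap of
  -- radius `s/2`.
  set κ : ℝ := 5 / a with hκ
  have hκ0 : 0 < κ := by positivity
  set V := volume.real (closedBall (0 : EuclideanSpace ℝ (Fin (d + 1))) 2) with hV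
  have hV0 : 0 ≤ V := measureReal_nonneg
  set A : ℝ := 64 * 16 ^ d * κ ^ γ with hA
  -- This is the multiple of `fluct` above which `ε` dominates `4q + 6Vδ`.
  set B : ℝ := 4 * (32 * 8 ^ d * 2 ^ γ * κ ^ γ) + 6 * V with hB
  have hA0 : 0 < A := by positivity
  have hB0 : 0 < B := by positivity
  refine ⟨1 / (8 * A ^ 2 + 2 * B ^ 2), by positivity, ?_⟩
  -- Chosen so that `capScale d r = 1/(2n)`; then `k z ≤ r` forces `4 s'² ≤ 1/n²`.
  set r : ℝ := (1 / (4 * ((d + 1 : ℕ) : ℝ))) ^ d with hr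
  have hr0 : 0 < r := by positivity
  have hsmall : ∀ᶠ N : ℕ in Filter.atTop, κ * (numCaps d N * (Real.log N / N)) ≤ r := by
    have := (tendsto_numCaps_mul_log_div d).const_mul κ
    rw [mul_zero] at this
    exact this.eventually_le_const hr0
  have hlogtend : Filter.Tendsto (fun N : ℕ => Real.log N) Filter.atTop Filter.atTop :=
    Real.tendsto_log_atTop.comp tendsto_natCast_atTop_atTop
  set R : ℝ := (surface (d + 1)).real Set.univ / volume.real (unitBall d) with hR
  have hR0 : 0 < R := div_pos (surface_univ_pos d) (volume_unitBall_pos d)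
  filter_upwards [hsmall, hlogtend.eventually_ge_atTop 1, hlogtend.eventually_ge_atTop (R / κ),
    Filter.eventually_ge_atTop 2] with N hN1 hlog hlogR hN2 ε hε
  have hNone : (1 : ℝ) < N := by exact_mod_cast hN2
  have hN0 : (0 : ℝ) < N := by linarith
  set k := numCaps d N with hk
  have hk1 : 1 ≤ k := one_le_numCaps d (by omega)
  have hk1' : (1 : ℝ) ≤ k := by exact_mod_cast hk1
  set L := Real.log N with hL
  set z : ℝ := κ * (L / N) with hz
  have hz0 : 0 < z := by positivity
  have haz : a * z = 5 * L / N := by rw [hz, hκ]; field_simp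
  set s := capScale d z with hs
  set s' := capScale d (k * z) with hs'
  have hs0 : 0 < s := by unfold s capScale; positivity
  have hss' : s ≤ s' := capScale_mono hz0.le (le_mul_of_one_le_left hz0.le hk1')
  have hs'r : s' ≤ 2 * (1 / (4 * ((d + 1 : ℕ) : ℝ))) := by
    have h1 : capScale d (k * z) ≤ capScale d r := by
      refine capScale_mono (by positivity) (le_of_eq_of_le ?_ hN1)
      rw [hz]; ring
    refine h1.trans_eq ?_
    rw [capScale, hr, ← Real.rpow_natCast, ← Real.rpow_mul (by positivity),
      mul_one_div_cancel hd0.ne', Real.rpow_one]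
  have hs'2 : 4 * s' ^ 2 ≤ 1 / ((d + 1 : ℕ) : ℝ) := by
    calc 4 * s' ^ 2 ≤ 4 * (2 * (1 / (4 * ((d + 1 : ℕ) : ℝ)))) ^ 2 := by
          have : 0 ≤ s' := hs0.le.trans hss'
          gcongr
      _ = 1 / ((d + 1 : ℕ) : ℝ) ^ 2 := by field_simp; norm_num
      _ ≤ _ := one_div_le_one_div_of_le (by positivity) (by nlinarith)
  have hs1 : 4 * s' ^ 2 ≤ 1 := hs'2.trans (by rw [div_le_one (by positivity)]; exact hd1)
  have hs2 : 4 * s' ^ 2 ≤ 2 / ((d + 1 : ℕ) : ℝ) := hs'2.trans (by gcongr; norm_num)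
  have hssq : s ^ 2 ≤ s' ^ 2 := by gcongr
  have heps : epsN (d + 1) N = (R / N) ^ (1 / (d : ℝ)) := epsN_eq d N
  -- It suffices that `ε_{n,N} ≤ s`. Since `ε_{n,N}` is `(R/N)^(1/d)`, the logarithm in `z` gives
  -- this once `L ≥ R/κ`.
  have ht : 1 - 4 * s ^ 2 ≤ tN (d + 1) N := by
    refine one_sub_le_tN (by linarith) ?_ ?_
    · rw [heps]; positivity
    · rw [heps]
      have : R / N ≤ z := by
        rw [hz, ← mul_div_assoc]
        gcongr
        rwa [div_le_iff₀ hκ0, mul_comm] at hlogR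
      have h2 : (R / N) ^ (1 / (d : ℝ)) ≤ z ^ (1 / (d : ℝ)) := by gcongr
      have h3 : 0 ≤ z ^ (1 / (d : ℝ)) := by positivity
      unfold s capScale
      linarith
  set δ := Real.exp (-(3 * (k * L))) with hδ
  have hbad : (1 / (a * (s / 2) ^ d)) ^ k * Real.exp (-(N * (k * (a * (s / 2) ^ d)))) +
      1 / (a * (s' / 2) ^ d) * Real.exp (-(N * (a * (s' / 2) ^ d))) ≤ δ := by
    rw [hs, hs', capScale_half_pow hd hz0.le, capScale_half_pow hd (by positivity), haz,
      show a * (k * z) = k * (a * z) by ring, haz]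
    exact bad_prob_le hN2 hlog hk1
  have hkL : L ≤ k * L := le_mul_of_one_le_left (by linarith) hk1'
  have hδfl : δ ≤ fluct d N :=
    (Real.exp_le_exp.mpr (by linarith)).trans (exp_neg_three_log_le_fluct hd hN2 hlog)
  have hδ2 : δ ≤ 1 / 2 := by
    rw [hδ, Real.exp_neg, one_div]
    refine inv_anti₀ (by norm_num) ?_
    linarith [Real.add_one_le_exp (3 * (k * L))]
  have hδtail : δ ≤ Real.exp (-(L * (N : ℝ) ^ (1 / 2 - 2 / (d : ℝ)))) := by
    refine Real.exp_le_exp.mpr (neg_le_neg ?_)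
    have h1 := rpow_le_numCaps hd (N := N) (by omega)
    have h2 : L * (N : ℝ) ^ (1 / 2 - 2 / (d : ℝ)) ≤ L * k := by gcongr
    nlinarith
  have hfl := fluct_pos (d := d) hN2
  set b := fluct d N with hb
  have hzγ : z ^ γ = κ ^ γ * (L / N) ^ γ := Real.mul_rpow hκ0.le (by positivity)
  have hq : k * (8 * s' ^ 2 * (4 * s) ^ d) ≤ 32 * 8 ^ d * 2 ^ γ * κ ^ γ * b := by
    rw [hs, hs', sector_volume_eq hd hz0 (by positivity), ← hγ, hzγ]
    calc _ ≤ 32 * 8 ^ d * (2 ^ γ * √N) * (κ ^ γ * (L / N) ^ γ) := by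
          gcongr; exact numCaps_rpow_le hd (by omega)
      _ = _ := by rw [hb, fluct]; ring
  rw [tailBound_eq hN2]
  rcases le_or_gt (B * b) ε with hεB | hεB
  · have hεcond : 4 * (k * (8 * s' ^ 2 * (4 * s) ^ d)) + 6 * V * δ ≤ ε := by
      refine le_trans ?_ hεB
      have : 6 * V * δ ≤ 6 * V * b := by gcongr
      rw [hB]; linarith
    refine (measureReal_symmVol_deviation_le hd ha hμ hs0 hss' hs1 hs2 N k ht hbad hδ2
      hεcond).trans ?_
    refine add_le_add (mul_le_mul_of_nonneg_left (Real.exp_le_exp.mpr ?_) (by norm_num)) hδtail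
    have hcap : N * (16 * s ^ 2 * (8 * s) ^ d) ^ 2 = A ^ 2 * b ^ 2 := by
      rw [hs, cap_volume_eq hd hz0, ← hγ, hzγ, hb, fluct, mul_pow √(N : ℝ), Real.sq_sqrt hN0.le]
      ring
    rw [hcap]
    exact gaussian_exponent_le hA0 hfl ε
  · refine measureReal_le_one.trans ((one_le_two_mul_exp (A := A) hB0 hfl hε.le hεB.le).trans ?_)
    exact le_add_of_nonneg_right (Real.exp_pos _).le

/-! ### Concentration for random points on any probability space -/

theorem concentration_of_chargesCaps {d : ℕ} (hd : 1 ≤ d) {μ : Measure (Sph (d + 1))}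
    [IsProbabilityMeasure μ] {a : ℝ} (ha : 0 < a) (hμ : ChargesCaps μ a) :
    ∃ c c₁ c₂ : ℝ, 0 < c ∧ 0 < c₁ ∧ 0 < c₂ ∧ ∃ N₀ : ℕ, ∀ N : ℕ, N₀ ≤ N →
      ∀ (Ω : Type u) [MeasurableSpace Ω] (Pr : Measure Ω) [IsProbabilityMeasure Pr]
        (X : Fin N → Ω → Sph (d + 1)), IsIID Pr X μ →
        1 - Real.exp (-(c₂ * N)) ≤ Pr.real {ω | Inside fun i => X i ω} ∧
        ∀ ε : ℝ, 0 < ε →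
          Pr.real {ω | ENNReal.ofReal ε ≤ absSub (symmVol fun i => X i ω) (condMean Pr X)}
            ≤ tailBound (d + 1) N c c₁ ε := by
  obtain ⟨c₂, hc₂, h₂⟩ := eventually_measureReal_inside_ge ha hμ
  obtain ⟨c, hc, h⟩ := eventually_deviation_le hd ha hμ
  obtain ⟨N₀, hN₀⟩ := Filter.eventually_atTop.mp (h₂.and h)
  refine ⟨c, 1, c₂, hc, one_pos, hc₂, N₀, fun N hN Ω _ Pr _ X hX => ?_⟩
  obtain ⟨h₂, h⟩ := hN₀ N hN
  refine ⟨?_, fun ε hε => ?_⟩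
  · rwa [← hX.measureReal_eq (measurableSet_inside (d + 1) N)] at h₂
  · have hmeas : MeasurableSet {x : Fin N → Sph (d + 1) |
        ENNReal.ofReal ε ≤ absSub (symmVol x) (condMean Pr X)} :=
      measurableSet_le measurable_const
        (measurable_absSub.comp ((measurable_symmVol (d + 1) N).prodMk measurable_const))
    have := h ε hε
    rw [← hX.condMean_eq, ← hX.measureReal_eq hmeas] at this
    exact this

end RandomPolytope

end

theorem theorem1 (n : ℕ) (hn : 2 ≤ n) :
    (∃ c c₁ c₂ : ℝ, 0 < c ∧ 0 < c₁ ∧ 0 < c₂ ∧ ∃ N₀ : ℕ, ∀ N : ℕ, N₀ ≤ N →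
      ∀ (Ω : Type u) [MeasurableSpace Ω] (Pr : Measure Ω) [IsProbabilityMeasure Pr]
        (X : Fin N → Ω → RandomPolytope.Sph n),
        RandomPolytope.IsIID Pr X (RandomPolytope.sigma n) →
        1 - Real.exp (-(c₂ * N)) ≤ Pr.real {ω | RandomPolytope.Inside fun i => X i ω} ∧
        ∀ ε : ℝ, 0 < ε →
          Pr.real {ω | ENNReal.ofReal ε ≤ RandomPolytope.absSub
              (RandomPolytope.symmVol fun i => X i ω) (RandomPolytope.condMean Pr X)}
            ≤ RandomPolytope.tailBound n N c c₁ ε) ∧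
    (∀ g : RandomPolytope.Sph n → ℝ, Continuous g → (∀ x, 0 < g x) →
      IsProbabilityMeasure (RandomPolytope.withDens n g) →
      ∃ c c₁ c₂ : ℝ, 0 < c ∧ 0 < c₁ ∧ 0 < c₂ ∧ ∃ N₀ : ℕ, ∀ N : ℕ, N₀ ≤ N →
      ∀ (Ω : Type u) [MeasurableSpace Ω] (Pr : Measure Ω) [IsProbabilityMeasure Pr]
        (X : Fin N → Ω → RandomPolytope.Sph n),
        RandomPolytope.IsIID Pr X (RandomPolytope.withDens n g) →
        1 - Real.exp (-(c₂ * N)) ≤ Pr.real {ω | RandomPolytope.Inside fun i => X i ω} ∧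
        ∀ ε : ℝ, 0 < ε →
          Pr.real {ω | ENNReal.ofReal ε ≤ RandomPolytope.absSub
              (RandomPolytope.symmVol fun i => X i ω) (RandomPolytope.condMean Pr X)}
            ≤ RandomPolytope.tailBound n N c c₁ ε) := by

  obtain ⟨d, rfl⟩ : ∃ d, n = d + 1 := ⟨n - 1, by omega⟩
  have hd : 1 ≤ d := by omega
  have hdens : ∀ g : RandomPolytope.Sph (d + 1) → ℝ, Continuous g → (∀ x, 0 < g x) →
      MeasureTheory.IsProbabilityMeasure (RandomPolytope.withDens (d + 1) g) → _ :=
    fun g hg hpos hp =>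
      let ⟨_, ha, hμ⟩ := RandomPolytope.exists_chargesCaps_withDens hd hg hpos hp
      RandomPolytope.concentration_of_chargesCaps.{u} hd ha hμ
  refine ⟨?_, hdens⟩
  -- Uniform measure is the density `g = 1`, so the first statement is a case of the second.
  have h := hdens (fun _ => 1) continuous_const (fun _ => one_pos)
    (by rw [RandomPolytope.withDens_one]; infer_instance)
  rwa [RandomPolytope.withDens_one] at h
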